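/- Let $G=(V,E,w)$ be a finite hypergraph with nonnegative real hyperedge weights $w:E\to\mathbb{R}_+$ and let $S\subseteq V$ be a set of Steiner nodes. For $t\subseteq E$ put $V(t)=\bigcup_{U\in t}U$ and $w(t)=\sum_{U\in t}w(U)$. Let $\mathcal{T}_S$ be the collection of all $t\subseteq E$ such that $S\subseteq V(t)$ and the hypergraph $(V(t),t)$ is connected, i.e. any two nodes of $V(t)$ are joined by a sequence of nodes in which consecutive ones lie in a common hyperedge of $t$ (so $t=\emptyset$ counts as connected). If $\mathcal{T}_S\neq\emptyset$, the minimum-cost hypergraph Steiner problem asks for $$\mathrm{HSP}(G,S)=\min_{t\in\mathcal{T}_S}w(t).$$ Theorem. There are a deterministic polynomial-time algorithm, and an absolute constant $C$, such that on every input $(G,S)$ the algorithm halts and decides whether $\mathcal{T}_S\neq\emptyset$, and, if so, returns some $t\in\mathcal{T}_S$ together with its cost $w(t)$, where $$\mathrm{HSP}(G,S)\le w(t)\le \max\{1,\,C\log|S|\}\cdot \mathrm{HSP}(G,S).$$ Thus $\mathrm{HSP}(G,S)$ is approximated within a factor $O(\log|S|)$ for $|S|\ge 2$ (and solved exactly for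 $|S|\le 1$, where $\log 0$ is read as $0$). In particular the approximation factor is at most $\max\{1,C\log|V|\}$, i.e. it is an $O(\log n)$-approximation algorithm with $n=|V|$. Here the algorithm is one fixed program for a unit-cost random access machine whose integer and real cells can be added, subtracted, compared, and accessed by address, with no multiplication and no conversion between reals and integers. The hypergraph is given by $|V|$, $|E|$, its incidence matrix, the indicator of $S$ and the weights (each in one real cell), and polynomial time means that the number of steps is at most $T(|V|+|E|)$ for a fixed polynomial $T$, independently of the weights. -/

import Mathlib

/-! ### Hypergraphs and the minimum-cost hypergraph Steiner problem -/

/-- A finite hypergraph with nonnegative real hyperedge weights.  The nodes are numbered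
`0, …, n - 1` and the hyperedges `0, …, m - 1`.  (Numbering the hyperedges makes parallel
hyperedges possible; they are allowed, and so are hyperedges of any size.) -/
structure WHypergraph (n m : ℕ) where
  edge : Fin m → Finset (Fin n)
  weight : Fin m → ℝ
  weight_nonneg : ∀ e, 0 ≤ weight e

namespace WHypergraph

variable {n m : ℕ} (G : WHypergraph n m)

/-- `V(t)`: the union of the hyperedges in `t`. -/
def span (t : Finset (Fin m)) : Finset (Fin n) := t.biUnion G.edge

/-- The subhypergraph `(V(t), t)` is connected: any two nodes of `V(t)` are joined by a path,
that is, by a sequence of nodes in which consecutive ones share a hyperedge of `t`. -/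
def IsConn (t : Finset (Fin m)) : Prop :=
  ∀ u ∈ G.span t, ∀ v ∈ G.span t,
    Relation.ReflTransGen (fun a b => ∃ e ∈ t, a ∈ G.edge e ∧ b ∈ G.edge e) u v

/-- `𝓣_S`: the sets of hyperedges that form a connected subhypergraph containing `S`. -/
def steinerSets (S : Finset (Fin n)) : Set (Finset (Fin m)) :=
  {t | G.IsConn t ∧ S ⊆ G.span t}

/-- The total weight of a set of hyperedges. -/
noncomputable def cost (t : Finset (Fin m)) : ℝ := ∑ e ∈ t, G.weight e

/-- `HSP(G, S)`, the minimum cost of a member of `𝓣_S` (see `isLeast_hsp`); it is meaningful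
only if `𝓣_S` is nonempty. -/
noncomputable def hsp (S : Finset (Fin n)) : ℝ := sInf (G.cost '' G.steinerSets S)

theorem isLeast_hsp (S : Finset (Fin n)) (h : (G.steinerSets S).Nonempty) :
    IsLeast (G.cost '' G.steinerSets S) (G.hsp S) :=
  have hf : (G.cost '' G.steinerSets S).Finite := (Set.toFinite (G.steinerSets S)).image G.cost
  ⟨(h.image _).csInf_mem hf, fun _ hc => csInf_le hf.bddBelow hc⟩

end WHypergraph

/-! ### The machine model: a unit-cost random access machine

The machine has integer registers, real registers, and named arrays of natural numbers and of
reals that are addressed through integer registers.  Its only arithmetic operations are addition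
and subtraction, its only tests are comparisons, and there is no conversion between reals and
integers.  Every instruction and every test costs one step.  There is no multiplication, so numbers
gain at most one bit per step. -/

namespace RAM

/-- A memory configuration. -/
structure State where
  /-- integer registers -/
  reg : ℕ → ℕ
  /-- integer arrays: `mem a i` is entry `i` of array `a` -/
  mem : ℕ → ℕ → ℕ
  /-- real registers -/
  rreg : ℕ → ℝ
  /-- real arrays: `rmem a i` is entry `i` of array `a` -/
  rmem : ℕ → ℕ → ℝ

/-- Elementary instructions.  Register and array names, and the constant in `const`, are fixed in
the program. -/
inductive Instr where
  | const (x c : ℕ)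
  | add (x y z : ℕ)
  | sub (x y z : ℕ)
  | load (x a y : ℕ)
  | store (a x y : ℕ)
  | radd (x y z : ℕ)
  | rsub (x y z : ℕ)
  | rload (x a y : ℕ)
  | rstore (a x y : ℕ)

/-- The effect of an instruction.  (`sub` is truncated subtraction of natural numbers.) -/
noncomputable def Instr.run : Instr → State → State
  | const x c, s => { s with reg := Function.update s.reg x c }
  | add x y z, s => { s with reg := Function.update s.reg x (s.reg y + s.reg z) }
  | sub x y z, s => { s with reg := Function.update s.reg x (s.reg y - s.reg z) }
  | load x a y, s => { s with reg := Function.update s.reg x (s.mem a (s.reg y)) }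
  | store a x y, s =>
      { s with mem := Function.update s.mem a (Function.update (s.mem a) (s.reg x) (s.reg y)) }
  | radd x y z, s => { s with rreg := Function.update s.rreg x (s.rreg y + s.rreg z) }
  | rsub x y z, s => { s with rreg := Function.update s.rreg x (s.rreg y - s.rreg z) }
  | rload x a y, s => { s with rreg := Function.update s.rreg x (s.rmem a (s.reg y)) }
  | rstore a x y, s =>
      { s with rmem := Function.update s.rmem a (Function.update (s.rmem a) (s.reg x) (s.rreg y)) }

/-- Tests: comparison of two integer registers or of two real registers. -/
inductive Test where
  | le (x y : ℕ)
  | rle (x y : ℕ)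

def Test.Holds : Test → State → Prop
  | le x y, s => s.reg x ≤ s.reg y
  | rle x y, s => s.rreg x ≤ s.rreg y

/-- Programs. -/
inductive Prog where
  | skip
  | instr (i : Instr)
  | seq (p q : Prog)
  | ite (b : Test) (p q : Prog)
  | loop (b : Test) (p : Prog)

/-- `Exec p s k s'`: started in `s`, the program `p` halts in `s'` after exactly `k` steps.
`loop b p` repeats `p` while `b` holds. -/
inductive Exec : Prog → State → ℕ → State → Prop where
  | skip (s : State) : Exec .skip s 1 s
  | instr (i : Instr) (s : State) : Exec (.instr i) s 1 (i.run s)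
  | seq {p q : Prog} {s s' s'' : State} {k l : ℕ} :
      Exec p s k s' → Exec q s' l s'' → Exec (.seq p q) s (k + l) s''
  | iteTrue {b : Test} {p q : Prog} {s s' : State} {k : ℕ} :
      b.Holds s → Exec p s k s' → Exec (.ite b p q) s (k + 1) s'
  | iteFalse {b : Test} {p q : Prog} {s s' : State} {k : ℕ} :
      ¬ b.Holds s → Exec q s k s' → Exec (.ite b p q) s (k + 1) s'
  | loopTrue {b : Test} {p : Prog} {s s' s'' : State} {k l : ℕ} :
      b.Holds s → Exec p s k s' → Exec (.loop b p) s' l s'' → Exec (.loop b p) s (k + l + 1) s''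
  | loopFalse {b : Test} {p : Prog} {s : State} :
      ¬ b.Holds s → Exec (.loop b p) s 1 s

/-- The machine is deterministic: a halting run has one final state and one running time. -/
theorem Exec.deterministic {p : Prog} {s s₁ s₂ : State} {k₁ k₂ : ℕ}
    (h₁ : Exec p s k₁ s₁) (h₂ : Exec p s k₂ s₂) : k₁ = k₂ ∧ s₁ = s₂ := by
  induction h₁ generalizing k₂ s₂ with
  | skip | instr => cases h₂; exact ⟨rfl, rfl⟩
  | seq _ _ ih ih' =>
    cases h₂ with
    | seq a b =>
      obtain ⟨rfl, rfl⟩ := ih a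
      obtain ⟨rfl, rfl⟩ := ih' b
      exact ⟨rfl, rfl⟩
  | iteTrue hb _ ih =>
    cases h₂ with
    | iteTrue _ a => obtain ⟨rfl, rfl⟩ := ih a; exact ⟨rfl, rfl⟩
    | iteFalse hb' _ => exact absurd hb hb'
  | iteFalse hb _ ih =>
    cases h₂ with
    | iteTrue hb' _ => exact absurd hb' hb
    | iteFalse _ a => obtain ⟨rfl, rfl⟩ := ih a; exact ⟨rfl, rfl⟩
  | loopTrue hb _ _ ih ih' =>
    cases h₂ with
    | loopTrue _ a b =>
      obtain ⟨rfl, rfl⟩ := ih a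
      obtain ⟨rfl, rfl⟩ := ih' b
      exact ⟨rfl, rfl⟩
    | loopFalse hb' => exact absurd hb hb'
  | loopFalse hb =>
    cases h₂ with
    | loopTrue hb' _ _ => exact absurd hb' hb
    | loopFalse _ => exact ⟨rfl, rfl⟩

open scoped Classical in
/-- The initial configuration for the instance `(G, S)`: integer registers `0` and `1` hold the
number `n` of nodes and the number `m` of hyperedges, integer array `0` holds the hyperedge-node
incidence matrix row by row, integer array `1` the indicator of `S`, and real array `0` the weights.
Everything else is `0`. -/
noncomputable def input {n m : ℕ} (G : WHypergraph n m) (S : Finset (Fin n)) : State where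
  reg x := if x = 0 then n else if x = 1 then m else 0
  mem a i :=
    if a = 0 then
      if ∃ (e : Fin m) (v : Fin n), i = (e : ℕ) * n + v ∧ v ∈ G.edge e then 1 else 0
    else if a = 1 then
      if ∃ v : Fin n, i = v ∧ v ∈ S then 1 else 0
    else 0
  rreg _ := 0
  rmem a i := if a = 0 then if h : i < m then G.weight ⟨i, h⟩ else 0 else 0

/-- The answer flag of a final configuration: integer register `0` holds `1`
(a solution is returned) rather than anything else (no solution is returned). -/
def State.Accepts (s : State) : Prop := s.reg 0 = 1

/-- The set of hyperedges returned by a final configuration: integer array `2` holds its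
indicator. -/
def State.outSet (s : State) (m : ℕ) : Finset (Fin m) :=
  Finset.univ.filter fun e => s.mem 2 e = 1

/-- The number returned by a final configuration: it is held in real register `0`. -/
def State.outValue (s : State) : ℝ := s.rreg 0

end RAM

/-! The algorithm is a greedy contraction in the spirit of Klein and Ravi's method for node-weighted
Steiner trees. It keeps a set `t` of bought hyperedges, whose residual weight is zero, and a set `R
⊆ S` of representatives; as long as `R` is nonempty, every node of `S` and of `V(t)` is joined in
`t` to a member of `R` (`Progress`). A star consists of a hyperedge `e` and cheapest chains of
hyperedges from `e` to all representatives (its feet) within some radius; its density is its cost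
divided by the number of feet. Each round buys a star of least density among those with at least two
feet and replaces the feet by one of them. A single remaining representative is removed by a star
with one foot, which ensures that it is covered; `R` is then empty and `t` is a solution.

The core is `Table.density_le`: if all stars with at least two feet have density at least `δ`, then
every connected set spanning `R` weighs at least `δ * |R|`, provided `|R| ≥ 2`. No decomposition
into stars is needed; the argument is a dual charging scheme. Each representative charges each
hyperedge for the part of it within distance `δ`. No hyperedge is charged more than its weight,
since the representatives closer than `δ` to it are the feet of a star (`Table.sum_charge_le`), and
every representative collects at least `δ` on its way to another one (`Table.min_le_sum_charge`).
Hence a least-density star with `j` of the `k` feet costs at most `j / k` times the optimum, while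
`k` drops by `j - 1`. As `j ≤ 2 * (j - 1)`, this telescopes to twice a harmonic sum
(`div_le_factor_sub`, `Table.starCost_le`), which is logarithmic.

If a solution exists, a star exists whenever `R` is nonempty (`Table.exists_isStar`), and every
purchase removes a representative, so `n` rounds empty `R`. Conversely an empty `R` certifies a
solution, so testing `R` decides feasibility.

It remains to run this on the machine. The program is written in a small language with bounded loops
and a total semantics, and `Cmd.comp_spec` compiles it with a polynomial time bound. Distances come
from Bellman–Ford rounds that store whole paths (`rounds_spec`); densities are compared by
cross-multiplication, with products formed by repeated addition. -/

namespace RAM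

/-! ### A small imperative language with bounded loops

Integer and real expressions, conditions and commands whose loops run over `i < n` or `i < m`.
Commands denote total functions on configurations; they compile to `Prog` with a running time
that is bounded by a polynomial read off from the syntax. -/

inductive IExp where
  | dimN
  | dimM
  | num (c : ℕ)
  | var (x : ℕ)
  | add (e f : IExp)
  | mulN (e : IExp)
  | mulM (e : IExp)
  | load (a : ℕ) (e : IExp)

inductive RExp where
  | zero
  | var (x : ℕ)
  | add (e f : RExp)
  | load (a : ℕ) (e : IExp)

inductive Cond where
  | le (e f : IExp)
  | eq (e f : IExp)
  | rle (e f : RExp)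
  | not (c : Cond)
  | and (c d : Cond)
  | or (c d : Cond)

inductive Cmd where
  | set (x : ℕ) (e : IExp)
  | store (a : ℕ) (i e : IExp)
  | rset (x : ℕ) (e : RExp)
  | rstore (a : ℕ) (i : IExp) (e : RExp)
  | seq (p q : Cmd)
  | when (c : Cond) (p : Cmd)
  | forN (x : ℕ) (p : Cmd)
  | forM (x : ℕ) (p : Cmd)

section Semantics

variable (n m : ℕ)

def IExp.eval (s : State) : IExp → ℕ
  | dimN => n
  | dimM => m
  | num c => c
  | var x => s.reg x
  | add e f => e.eval s + f.eval s
  | mulN e => e.eval s * n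
  | mulM e => e.eval s * m
  | load a e => s.mem a (e.eval s)

noncomputable def RExp.eval (s : State) : RExp → ℝ
  | zero => 0
  | var x => s.rreg x
  | add e f => e.eval s + f.eval s
  | load a e => s.rmem a (e.eval n m s)

def Cond.Holds (s : State) : Cond → Prop
  | le e f => e.eval n m s ≤ f.eval n m s
  | eq e f => e.eval n m s = f.eval n m s
  | rle e f => e.eval n m s ≤ f.eval n m s
  | not c => ¬ c.Holds s
  | and c d => c.Holds s ∧ d.Holds s
  | or c d => c.Holds s ∨ d.Holds s

/-- The configuration `s` with integer register `x` set to `i`. -/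
def State.setReg (s : State) (x i : ℕ) : State := { s with reg := Function.update s.reg x i }

/-- Run `f 0, …, f (b - 1)` in this order, after setting register `x` to the index. -/
def iter (x : ℕ) (f : State → State) : ℕ → State → State
  | 0, s => s
  | b + 1, s => f ((iter x f b s).setReg x b)

open scoped Classical in
noncomputable def Cmd.den : Cmd → State → State
  | set x e, s => s.setReg x (e.eval n m s)
  | store a i e, s =>
      { s with mem := Function.update s.mem a
                (Function.update (s.mem a) (i.eval n m s) (e.eval n m s)) }
  | rset x e, s => { s with rreg := Function.update s.rreg x (e.eval n m s) }
  | rstore a i e, s =>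
      { s with rmem := Function.update s.rmem a
                (Function.update (s.rmem a) (i.eval n m s) (e.eval n m s)) }
  | seq p q, s => q.den (p.den s)
  | when c p, s => if c.Holds n m s then p.den s else s
  | forN x p, s => iter x p.den n s
  | forM x p, s => iter x p.den m s

end Semantics

/-! ### Compilation

Source register `x` is kept in machine register `2 * x`; the odd registers hold the constants
(`1 ↦ m`, `3 ↦ n`, `5 ↦ 1`, `7 ↦ 0`, real register `1 ↦ 0`) and temporaries: code compiled at
depth `d` uses the odd registers from `2 * d + 1` on. -/

/-- `for c = 1, …, reg b do body`, with counter register `c`. -/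
def Prog.count (c b : ℕ) (body : Prog) : Prog :=
  .seq (.instr (.const c 1)) (.loop (.le c b) (.seq body (.instr (.add c c 5))))

def mulProg (b d : ℕ) : Prog :=
  .seq (.instr (.const (2 * d + 1) 0))
    (.count (2 * (d + 2) + 1) b (.instr (.add (2 * d + 1) (2 * d + 1) (2 * (d + 1) + 1))))

def IExp.comp : ℕ → IExp → Prog
  | d, dimN => .instr (.add (2 * d + 1) 3 7)
  | d, dimM => .instr (.add (2 * d + 1) 1 7)
  | d, num c => .instr (.const (2 * d + 1) c)
  | d, var x => .instr (.add (2 * d + 1) (2 * x) 7)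
  | d, add e f => .seq (e.comp d) (.seq (f.comp (d + 1))
      (.instr (.add (2 * d + 1) (2 * d + 1) (2 * (d + 1) + 1))))
  | d, mulN e => .seq (e.comp (d + 1)) (mulProg 3 d)
  | d, mulM e => .seq (e.comp (d + 1)) (mulProg 1 d)
  | d, load a e => .seq (e.comp d) (.instr (.load (2 * d + 1) a (2 * d + 1)))

def RExp.comp : ℕ → RExp → Prog
  | d, zero => .instr (.radd (2 * d + 1) 1 1)
  | d, var x => .instr (.radd (2 * d + 1) (2 * x) 1)
  | d, add e f => .seq (e.comp d) (.seq (f.comp (d + 1))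
      (.instr (.radd (2 * d + 1) (2 * d + 1) (2 * (d + 1) + 1))))
  | d, load a e => .seq (e.comp d) (.instr (.rload (2 * d + 1) a (2 * d + 1)))

def setFlag (t : Test) (d : ℕ) : Prog :=
  .ite t (.instr (.const (2 * d + 1) 1)) (.instr (.const (2 * d + 1) 0))

/-- The temporary `2 * d + 1` receives the truth value, as `1` or `0`. -/
def Cond.comp : ℕ → Cond → Prog
  | d, le e f => .seq (e.comp d) (.seq (f.comp (d + 1))
      (setFlag (.le (2 * d + 1) (2 * (d + 1) + 1)) d))
  | d, eq e f => .seq (e.comp d) (.seq (f.comp (d + 1))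
      (.ite (.le (2 * d + 1) (2 * (d + 1) + 1))
        (setFlag (.le (2 * (d + 1) + 1) (2 * d + 1)) d)
        (.instr (.const (2 * d + 1) 0))))
  | d, rle e f => .seq (e.comp d) (.seq (f.comp (d + 1))
      (setFlag (.rle (2 * d + 1) (2 * (d + 1) + 1)) d))
  | d, not c => .seq (c.comp d) (.instr (.sub (2 * d + 1) 5 (2 * d + 1)))
  | d, and b c => .seq (b.comp d) (.ite (.le 5 (2 * d + 1)) (c.comp d) .skip)
  | d, or b c => .seq (b.comp d) (.ite (.le 5 (2 * d + 1)) .skip (c.comp d))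

/-- A loop counts in the temporary of depth `d` and compiles its body at depth `d + 1`, so the body
cannot disturb the counter even if it overwrites the loop variable. Counters start at `1`, hence the
subtraction of the constant `1` in register `5`. -/
def Cmd.comp : ℕ → Cmd → Prog
  | d, set x e => .seq (e.comp d) (.instr (.add (2 * x) (2 * d + 1) 7))
  | d, store a i e => .seq (i.comp d) (.seq (e.comp (d + 1))
      (.instr (.store a (2 * d + 1) (2 * (d + 1) + 1))))
  | d, rset x e => .seq (e.comp d) (.instr (.radd (2 * x) (2 * d + 1) 1))
  | d, rstore a i e => .seq (i.comp d) (.seq (e.comp (d + 1))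
      (.instr (.rstore a (2 * d + 1) (2 * (d + 1) + 1))))
  | d, seq p q => .seq (p.comp d) (q.comp d)
  | d, when c p => .seq (c.comp d) (.ite (.le 5 (2 * d + 1)) (p.comp d) .skip)
  | d, forN x p => .count (2 * d + 1) 3
      (.seq (.instr (.sub (2 * x) (2 * d + 1) 5)) (p.comp (d + 1)))
  | d, forM x p => .count (2 * d + 1) 1
      (.seq (.instr (.sub (2 * x) (2 * d + 1) 5)) (p.comp (d + 1)))

/-! ### Running times -/

-- The variable stands for `n + m`, which dominates the number of iterations of both kinds of loop.
-- A product costs linear time because it is a loop of additions.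
open Polynomial in
noncomputable def IExp.time : IExp → Polynomial ℕ
  | dimN | dimM | num _ | var _ => 1
  | add e f => e.time + f.time + 1
  | mulN e | mulM e => e.time + 3 * X + 3
  | load _ e => e.time + 1

noncomputable def RExp.time : RExp → Polynomial ℕ
  | zero | var _ => 1
  | add e f => e.time + f.time + 1
  | load _ e => e.time + 1

noncomputable def Cond.time : Cond → Polynomial ℕ
  | le e f => e.time + f.time + 3
  | eq e f => e.time + f.time + 3
  | rle e f => e.time + f.time + 3
  | not c => c.time + 1
  | and c d => c.time + d.time + 2
  | or c d => c.time + d.time + 2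

open Polynomial in
noncomputable def Cmd.time : Cmd → Polynomial ℕ
  | set _ e => e.time + 1
  | store _ i e => i.time + e.time + 1
  | rset _ e => e.time + 1
  | rstore _ i e => i.time + e.time + 1
  | seq p q => p.time + q.time
  | when c p => c.time + p.time + 2
  | forN _ p | forM _ p => X * (p.time + 3) + 2

/-! ### Correctness of the compilation -/

/-- Machine configuration `σ` represents source configuration `s`. -/
structure Sim (n m : ℕ) (s σ : State) : Prop where
  reg : ∀ x, σ.reg (2 * x) = s.reg x
  mem : σ.mem = s.mem
  rreg : ∀ x, σ.rreg (2 * x) = s.rreg x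
  rmem : σ.rmem = s.rmem
  dimM : σ.reg 1 = m
  dimN : σ.reg 3 = n
  one : σ.reg 5 = 1
  zero : σ.reg 7 = 0
  rzero : σ.rreg 1 = 0

/-- The temporaries below depth `d` agree. -/
def Keep (d : ℕ) (σ σ' : State) : Prop :=
  ∀ j < d, σ'.reg (2 * j + 1) = σ.reg (2 * j + 1) ∧ σ'.rreg (2 * j + 1) = σ.rreg (2 * j + 1)

theorem Keep.refl (d : ℕ) (σ : State) : Keep d σ σ := fun _ _ => ⟨rfl, rfl⟩

theorem Keep.trans {d : ℕ} {σ σ' σ'' : State} (h : Keep d σ σ') (h' : Keep d σ' σ'') :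
    Keep d σ σ'' := fun j hj =>
  ⟨(h' j hj).1.trans (h j hj).1, (h' j hj).2.trans (h j hj).2⟩

theorem Keep.mono {d d' : ℕ} {σ σ' : State} (h : Keep d σ σ') (hd : d' ≤ d) : Keep d' σ σ' :=
  fun j hj => h j (hj.trans_le hd)

theorem Keep.setReg (d : ℕ) (σ : State) {j : ℕ} (hj : d ≤ j) (v : ℕ) :
    Keep d σ (σ.setReg (2 * j + 1) v) := fun i hi =>
  ⟨Function.update_of_ne (by omega) _ _, rfl⟩

def State.setRreg (s : State) (x : ℕ) (r : ℝ) : State :=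
  { s with rreg := Function.update s.rreg x r }

theorem Keep.setRreg (d : ℕ) (σ : State) {j : ℕ} (hj : d ≤ j) (v : ℝ) :
    Keep d σ (σ.setRreg (2 * j + 1) v) := fun i hi =>
  ⟨rfl, Function.update_of_ne (by omega) _ _⟩

@[simp] theorem State.setReg_reg_self (s : State) (x v : ℕ) : (s.setReg x v).reg x = v :=
  Function.update_self ..

theorem State.setReg_reg_of_ne (s : State) {x y : ℕ} (v : ℕ) (h : y ≠ x) :
    (s.setReg x v).reg y = s.reg y := Function.update_of_ne h _ _

@[simp] theorem State.setRreg_rreg_self (s : State) (x : ℕ) (v : ℝ) :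
    (s.setRreg x v).rreg x = v := Function.update_self ..

variable {n m : ℕ} {s σ : State}

theorem Sim.setTemp (h : Sim n m s σ) {d : ℕ} (hd : 4 ≤ d) (v : ℕ) :
    Sim n m s (σ.setReg (2 * d + 1) v) where
  reg x := (σ.setReg_reg_of_ne v (by omega)).trans (h.reg x)
  mem := h.mem
  rreg := h.rreg
  rmem := h.rmem
  dimM := (σ.setReg_reg_of_ne v (by omega)).trans h.dimM
  dimN := (σ.setReg_reg_of_ne v (by omega)).trans h.dimN
  one := (σ.setReg_reg_of_ne v (by omega)).trans h.one
  zero := (σ.setReg_reg_of_ne v (by omega)).trans h.zero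
  rzero := h.rzero

theorem Sim.setRTemp (h : Sim n m s σ) {d : ℕ} (hd : 4 ≤ d) (v : ℝ) :
    Sim n m s (σ.setRreg (2 * d + 1) v) where
  reg := h.reg
  mem := h.mem
  rreg x := (Function.update_of_ne (by omega) _ _).trans (h.rreg x)
  rmem := h.rmem
  dimM := h.dimM
  dimN := h.dimN
  one := h.one
  zero := h.zero
  rzero := (Function.update_of_ne (by omega) _ _).trans h.rzero

theorem Sim.setReg (h : Sim n m s σ) (x v : ℕ) :
    Sim n m (s.setReg x v) (σ.setReg (2 * x) v) where
  reg y := by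
    by_cases hy : y = x
    · subst hy; simp
    · rw [State.setReg_reg_of_ne _ _ (by omega), State.setReg_reg_of_ne _ _ hy, h.reg]
  mem := h.mem
  rreg := h.rreg
  rmem := h.rmem
  dimM := (σ.setReg_reg_of_ne v (by omega)).trans h.dimM
  dimN := (σ.setReg_reg_of_ne v (by omega)).trans h.dimN
  one := (σ.setReg_reg_of_ne v (by omega)).trans h.one
  zero := (σ.setReg_reg_of_ne v (by omega)).trans h.zero
  rzero := h.rzero

theorem Sim.setRreg (h : Sim n m s σ) (x : ℕ) (v : ℝ) :
    Sim n m (s.setRreg x v) (σ.setRreg (2 * x) v) where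
  reg := h.reg
  mem := h.mem
  rreg y := by
    by_cases hy : y = x
    · subst hy; simp
    · exact (Function.update_of_ne (by omega) _ _).trans
        ((h.rreg y).trans (Function.update_of_ne hy _ _).symm)
  rmem := h.rmem
  dimM := h.dimM
  dimN := h.dimN
  one := h.one
  zero := h.zero
  rzero := (Function.update_of_ne (by omega) _ _).trans h.rzero

/-- From `σ`, the program `p` halts within `K` steps in a configuration satisfying `Q`. -/
def Ensures (p : Prog) (σ : State) (K : ℕ) (Q : State → Prop) : Prop :=
  ∃ k σ', Exec p σ k σ' ∧ k ≤ K ∧ Q σ'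

theorem Ensures.seq {p q : Prog} {K L : ℕ} {Q Q' : State → Prop}
    (h : Ensures p σ K Q) (h' : ∀ σ', Q σ' → Ensures q σ' L Q') :
    Ensures (.seq p q) σ (K + L) Q' := by
  obtain ⟨k, σ', he, hk, hq⟩ := h
  obtain ⟨l, σ'', he', hl, hq'⟩ := h' σ' hq
  exact ⟨_, _, .seq he he', add_le_add hk hl, hq'⟩

theorem Ensures.mono {p : Prog} {K K' : ℕ} {Q Q' : State → Prop}
    (h : Ensures p σ K Q) (hK : K ≤ K') (hQ : ∀ σ', Q σ' → Q' σ') : Ensures p σ K' Q' := by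
  obtain ⟨k, σ', he, hk, hq⟩ := h
  exact ⟨_, _, he, hk.trans hK, hQ _ hq⟩

theorem Ensures.instr {i : Instr} {Q : State → Prop} (h : Q (i.run σ)) :
    Ensures (.instr i) σ 1 Q := ⟨_, _, .instr i σ, le_rfl, h⟩

theorem Ensures.skip {Q : State → Prop} (h : Q σ) : Ensures .skip σ 1 Q :=
  ⟨_, _, .skip σ, le_rfl, h⟩

theorem Ensures.ite {b : Test} {p q : Prog} {K : ℕ} {Q : State → Prop}
    (h : b.Holds σ → Ensures p σ K Q) (h' : ¬ b.Holds σ → Ensures q σ K Q) :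
    Ensures (.ite b p q) σ (K + 1) Q := by
  by_cases hb : b.Holds σ
  · obtain ⟨k, σ', he, hk, hq⟩ := h hb
    exact ⟨_, _, .iteTrue hb he, by omega, hq⟩
  · obtain ⟨k, σ', he, hk, hq⟩ := h' hb
    exact ⟨_, _, .iteFalse hb he, by omega, hq⟩

/-- The induction is on the number `r` of iterations still to come. After `i` iterations the counter
is `i + 1`, so the test of the loop amounts to `i < B`. -/
theorem Ensures.loop {c b B K : ℕ} {p : Prog} (I : ℕ → State → Prop)
    (hb : ∀ i σ, I i σ → σ.reg b = B) (hc : ∀ i σ, I i σ → σ.reg c = i + 1)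
    (hbody : ∀ i σ, i < B → I i σ → Ensures p σ K (I (i + 1))) :
    ∀ r i σ, i + r = B → I i σ → Ensures (.loop (.le c b) p) σ (r * (K + 1) + 1) (I B) := by
  intro r
  induction r with
  | zero =>
    intro i σ hi h
    refine ⟨1, σ, .loopFalse ?_, by omega, by rwa [← hi]⟩
    simp only [Test.Holds, hb i σ h, hc i σ h]; omega
  | succ r ih =>
    intro i σ hi h
    obtain ⟨k, σ', he, hk, hq⟩ := hbody i σ (by omega) h
    obtain ⟨l, σ'', he', hl, hq'⟩ := ih (i + 1) σ' (by omega) hq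
    refine ⟨_, _, .loopTrue ?_ he he', ?_, hq'⟩
    · simp only [Test.Holds, hb i σ h, hc i σ h]; omega
    · rw [add_mul]; omega

/-- The invariant is required to be insensitive to the counter, so that only the bookkeeping here
has to mention it. -/
theorem Ensures.count {c b B K : ℕ} {p : Prog} (I : ℕ → State → Prop)
    (hb : ∀ i σ, I i σ → σ.reg b = B)
    (hone : ∀ i σ, I i σ → σ.reg 5 = 1)
    (hI : ∀ i σ v, I i σ → I i (σ.setReg c v))
    (hbody : ∀ i σ, i < B → I i σ → σ.reg c = i + 1 →
      Ensures p σ K (fun σ' => I (i + 1) σ' ∧ σ'.reg c = i + 1))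
    (h0 : I 0 σ) : Ensures (.count c b p) σ (B * (K + 2) + 2) (I B) := by
  have key := Ensures.loop (c := c) (b := b) (B := B) (K := K + 1)
    (p := .seq p (.instr (.add c c 5))) (fun i σ => I i σ ∧ σ.reg c = i + 1)
    (fun i σ h => hb i σ h.1) (fun i σ h => h.2) ?_ B 0 (σ.setReg c 1) (by omega)
    ⟨hI _ _ _ h0, by simp⟩
  · refine Ensures.mono (Ensures.seq (Q := fun σ' => σ' = σ.setReg c 1) (L := B * (K + 2) + 1)
      (Ensures.instr rfl) ?_) (by omega) (fun σ' h => h)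
    rintro _ rfl
    exact key.mono le_rfl fun _ h => h.1
  · rintro i σ hi ⟨h, h'⟩
    refine (hbody i σ hi h h').seq fun σ' h => Ensures.instr ⟨?_, ?_⟩
    · exact hI _ _ (σ'.reg c + σ'.reg 5) h.1
    · simp [Instr.run, h.2, hone _ _ h.1]

/-- The postcondition of code that evaluates an integer into the temporary at depth `d`. -/
def IPost (n m : ℕ) (s σ : State) (d v : ℕ) (σ' : State) : Prop :=
  Sim n m s σ' ∧ Keep d σ σ' ∧ σ'.reg (2 * d + 1) = v

theorem IPost.setReg (h : Sim n m s σ) {τ : State} {d : ℕ} (hd : 4 ≤ d) (hk : Keep d τ σ)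
    (v : ℕ) : IPost n m s τ d v (σ.setReg (2 * d + 1) v) :=
  ⟨h.setTemp hd v, hk.trans (Keep.setReg d σ le_rfl v), by simp⟩

theorem mulProg_spec (h : Sim n m s σ) {b B d v : ℕ} (hd : 4 ≤ d) (hB : B ≤ n + m)
    (hσb : ∀ σ, Sim n m s σ → σ.reg b = B)
    (hv : σ.reg (2 * (d + 1) + 1) = v) :
    Ensures (mulProg b d) σ (3 * (n + m) + 3) (IPost n m s σ d (v * B)) := by
  refine Ensures.mono (Ensures.seq (Q := fun σ' => σ' = σ.setReg (2 * d + 1) 0)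
      (L := B * (1 + 2) + 2) (Ensures.instr rfl) ?_) (by omega) (fun σ' h => h)
  rintro _ rfl
  refine Ensures.mono (Ensures.count (B := B) (K := 1)
    (fun i σ' => IPost n m s σ d (v * i) σ' ∧ σ'.reg (2 * (d + 1) + 1) = v)
    (fun i σ h => hσb σ h.1.1) (fun i σ h => h.1.1.one) ?_ ?_ ?_) le_rfl
    (fun σ' h => h.1)
  · rintro i τ w ⟨⟨h1, h2, h3⟩, h4⟩
    refine ⟨⟨h1.setTemp (by omega) w, h2.trans (Keep.setReg _ _ (by omega) w), ?_⟩, ?_⟩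
    · rwa [State.setReg_reg_of_ne _ _ (by omega)]
    · rwa [State.setReg_reg_of_ne _ _ (by omega)]
  · rintro i τ hi ⟨⟨h1, h2, h3⟩, h4⟩ h5
    refine Ensures.instr ⟨⟨?_, ?_⟩, ?_⟩
    · have := IPost.setReg h1 hd h2 (v * (i + 1))
      convert this using 1
      simp only [Instr.run, State.setReg, h3, show τ.reg (2 * (d + 1) + 1) = v from h4, mul_add v,
        mul_one]
    · exact (State.setReg_reg_of_ne τ _ (by omega)).trans h4
    · exact (State.setReg_reg_of_ne τ _ (by omega)).trans h5
  · exact ⟨by simpa using IPost.setReg h hd (Keep.refl _ _) 0,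
      (State.setReg_reg_of_ne σ _ (by omega)).trans hv⟩

/-- Temporaries form a stack: a second operand is evaluated one level deeper, and `Keep` guarantees
that the first operand survives. -/
theorem IExp.comp_spec (e : IExp) : ∀ {d : ℕ} {σ : State}, 4 ≤ d → Sim n m s σ →
    Ensures (e.comp d) σ (e.time.eval (n + m)) (IPost n m s σ d (e.eval n m s)) := by
  induction e with
  | dimN =>
    intro d σ hd h
    simp only [time, Polynomial.eval_one]
    refine Ensures.instr ?_
    convert IPost.setReg h hd (Keep.refl _ _) (eval n m s dimN) using 1
    simp [Instr.run, State.setReg, eval, h.dimN, h.zero]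
  | dimM =>
    intro d σ hd h
    simp only [time, Polynomial.eval_one]
    refine Ensures.instr ?_
    convert IPost.setReg h hd (Keep.refl _ _) (eval n m s dimM) using 1
    simp [Instr.run, State.setReg, eval, h.dimM, h.zero]
  | num c =>
    intro d σ hd h
    simp only [time, Polynomial.eval_one]
    exact Ensures.instr (IPost.setReg h hd (Keep.refl _ _) c)
  | var x =>
    intro d σ hd h
    simp only [time, Polynomial.eval_one]
    refine Ensures.instr ?_
    convert IPost.setReg h hd (Keep.refl _ _) (eval n m s (var x)) using 1
    simp [Instr.run, State.setReg, eval, h.reg, h.zero]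
  | add e f ihe ihf =>
    intro d σ hd h
    simp only [time, Polynomial.eval_add, Polynomial.eval_one, add_assoc]
    refine (ihe hd h).seq fun σ₁ h₁ => (ihf (d := d + 1) (by omega) h₁.1).seq fun σ₂ h₂ =>
      Ensures.instr ?_
    convert IPost.setReg h₂.1 hd (h₁.2.1.trans (h₂.2.1.mono (by omega)))
      (eval n m s (e.add f)) using 1
    simp only [Instr.run, State.setReg, eval, h₂.2.2, (h₂.2.1 d (by omega)).1, h₁.2.2]
  | mulN e ih =>
    intro d σ hd h
    simp only [time, Polynomial.eval_add, Polynomial.eval_mul, Polynomial.eval_ofNat,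
      Polynomial.eval_X, add_assoc]
    refine (ih (d := d + 1) (by omega) h).seq fun σ₁ h₁ => ?_
    exact (mulProg_spec h₁.1 hd (by omega) (fun _ h => h.dimN) h₁.2.2).mono le_rfl
      fun σ' h' => ⟨h'.1, (h₁.2.1.mono (by omega)).trans h'.2.1, h'.2.2⟩
  | mulM e ih =>
    intro d σ hd h
    simp only [time, Polynomial.eval_add, Polynomial.eval_mul, Polynomial.eval_ofNat,
      Polynomial.eval_X, add_assoc]
    refine (ih (d := d + 1) (by omega) h).seq fun σ₁ h₁ => ?_
    exact (mulProg_spec h₁.1 hd (by omega) (fun _ h => h.dimM) h₁.2.2).mono le_rfl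
      fun σ' h' => ⟨h'.1, (h₁.2.1.mono (by omega)).trans h'.2.1, h'.2.2⟩
  | load a e ih =>
    intro d σ hd h
    simp only [time, Polynomial.eval_add, Polynomial.eval_one]
    refine (ih hd h).seq fun σ₁ h₁ => Ensures.instr ?_
    convert IPost.setReg h₁.1 hd h₁.2.1 (eval n m s (load a e)) using 1
    simp only [eval, Instr.run, State.setReg, h₁.2.2, h₁.1.mem]

/-- The postcondition of code that evaluates a real into the temporary at depth `d`. -/
def RPost (n m : ℕ) (s σ : State) (d : ℕ) (v : ℝ) (σ' : State) : Prop :=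
  Sim n m s σ' ∧ Keep d σ σ' ∧ σ'.rreg (2 * d + 1) = v

theorem RPost.setRreg (h : Sim n m s σ) {τ : State} {d : ℕ} (hd : 4 ≤ d) (hk : Keep d τ σ)
    (v : ℝ) : RPost n m s τ d v (σ.setRreg (2 * d + 1) v) :=
  ⟨h.setRTemp hd v, hk.trans (Keep.setRreg d σ le_rfl v), by simp⟩

theorem RExp.comp_spec (e : RExp) : ∀ {d : ℕ} {σ : State}, 4 ≤ d → Sim n m s σ →
    Ensures (e.comp d) σ (e.time.eval (n + m)) (RPost n m s σ d (e.eval n m s)) := by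
  induction e with
  | zero =>
    intro d σ hd h
    simp only [time, Polynomial.eval_one]
    refine Ensures.instr ?_
    convert RPost.setRreg h hd (Keep.refl _ _) (eval n m s zero) using 1
    simp [Instr.run, State.setRreg, eval, h.rzero]
  | var x =>
    intro d σ hd h
    simp only [time, Polynomial.eval_one]
    refine Ensures.instr ?_
    convert RPost.setRreg h hd (Keep.refl _ _) (eval n m s (var x)) using 1
    simp [Instr.run, State.setRreg, eval, h.rreg, h.rzero]
  | add e f ihe ihf =>
    intro d σ hd h
    simp only [time, Polynomial.eval_add, Polynomial.eval_one, add_assoc]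
    refine (ihe hd h).seq fun σ₁ h₁ => (ihf (d := d + 1) (by omega) h₁.1).seq fun σ₂ h₂ =>
      Ensures.instr ?_
    convert RPost.setRreg h₂.1 hd (h₁.2.1.trans (h₂.2.1.mono (by omega)))
      (eval n m s (e.add f)) using 1
    simp only [Instr.run, State.setRreg, eval, h₂.2.2, (h₂.2.1 d (by omega)).2, h₁.2.2]
  | load a e =>
    intro d σ hd h
    simp only [time, Polynomial.eval_add, Polynomial.eval_one]
    refine (e.comp_spec hd h).seq fun σ₁ h₁ => Ensures.instr ?_
    convert RPost.setRreg h₁.1 hd h₁.2.1 (eval n m s (load a e)) using 1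
    simp only [eval, Instr.run, State.setRreg, h₁.2.2, h₁.1.rmem]

open scoped Classical in
theorem setFlag_spec (h : Sim n m s σ) {τ : State} {d : ℕ} (hd : 4 ≤ d) (hk : Keep d τ σ)
    {t : Test} {P : Prop} (ht : t.Holds σ ↔ P) :
    Ensures (setFlag t d) σ 2 (IPost n m s τ d (if P then 1 else 0)) := by
  refine Ensures.ite (fun hb => Ensures.instr ?_) (fun hb => Ensures.instr ?_)
  · rw [if_pos (ht.1 hb)]; exact IPost.setReg h hd hk 1
  · rw [if_neg (fun h => hb (ht.2 h))]; exact IPost.setReg h hd hk 0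

open scoped Classical in
theorem Cond.comp_spec (c : Cond) : ∀ {d : ℕ} {σ : State}, 4 ≤ d → Sim n m s σ →
    Ensures (c.comp d) σ (c.time.eval (n + m))
      (IPost n m s σ d (if c.Holds n m s then 1 else 0)) := by
  induction c with
  | le e f =>
    intro d σ hd h
    simp only [time, Polynomial.eval_add, Polynomial.eval_ofNat, add_assoc]
    refine (e.comp_spec hd h).seq fun σ₁ h₁ => Ensures.mono ((f.comp_spec (d := d + 1) (by omega)
      h₁.1).seq fun σ₂ h₂ => setFlag_spec h₂.1 hd (h₁.2.1.trans (h₂.2.1.mono (by omega))) ?_)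
      (by omega) fun _ h => h
    simp only [Test.Holds, Holds, h₂.2.2, (h₂.2.1 d (by omega)).1, h₁.2.2]
  | eq e f =>
    intro d σ hd h
    simp only [time, Polynomial.eval_add, Polynomial.eval_ofNat, add_assoc]
    refine (e.comp_spec hd h).seq fun σ₁ h₁ => Ensures.mono ((f.comp_spec (d := d + 1) (by omega)
      h₁.1).seq fun σ₂ h₂ => Ensures.ite (K := 2) (fun hb => setFlag_spec h₂.1 hd
        (h₁.2.1.trans (h₂.2.1.mono (by omega))) ?_) (fun hb => ?_))
      le_rfl fun _ h => h
    all_goals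
      simp only [Test.Holds, h₂.2.2, (h₂.2.1 d (by omega)).1, h₁.2.2] at hb ⊢
    · simp only [Holds]; omega
    · rw [if_neg (by simp only [Holds]; omega)]
      exact (Ensures.instr (IPost.setReg h₂.1 hd (h₁.2.1.trans (h₂.2.1.mono (by omega))) 0)).mono
        (by omega) fun _ h => h
  | rle e f =>
    intro d σ hd h
    simp only [time, Polynomial.eval_add, Polynomial.eval_ofNat, add_assoc]
    refine (e.comp_spec hd h).seq fun σ₁ h₁ => Ensures.mono ((f.comp_spec (d := d + 1) (by omega)
      h₁.1).seq fun σ₂ h₂ => setFlag_spec h₂.1 hd (h₁.2.1.trans (h₂.2.1.mono (by omega))) ?_)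
      (by omega) fun _ h => h
    simp only [Test.Holds, Holds, h₂.2.2, (h₂.2.1 d (by omega)).2, h₁.2.2]
  | not c ih =>
    intro d σ hd h
    simp only [time, Polynomial.eval_add, Polynomial.eval_one]
    refine (ih hd h).seq fun σ₁ h₁ => Ensures.instr ?_
    convert IPost.setReg h₁.1 hd h₁.2.1 (if (Cond.not c).Holds n m s then 1 else 0) using 1
    simp only [Instr.run, State.setReg, h₁.2.2, h₁.1.one, Holds]
    split_ifs <;> simp_all
  | and b c ihb ihc =>
    intro d σ hd h
    simp only [time, Polynomial.eval_add, Polynomial.eval_ofNat, add_assoc]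
    refine (ihb hd h).seq fun σ₁ h₁ => Ensures.mono (Ensures.ite
      (K := c.time.eval (n + m) + 1) (fun hb => ?_) (fun hb => ?_)) (by omega) fun _ h => h
    all_goals simp only [Test.Holds, h₁.1.one, h₁.2.2] at hb
    · have : b.Holds n m s := by by_contra h; simp [h] at hb
      simp only [Holds, this, true_and]
      exact (ihc hd h₁.1).mono (by omega) fun σ' h' => ⟨h'.1, h₁.2.1.trans h'.2.1, h'.2.2⟩
    · have : ¬ b.Holds n m s := by intro h; simp [h] at hb
      simp only [this, if_false] at h₁
      simp only [Holds, this, false_and, if_false]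
      exact (Ensures.skip h₁).mono (by omega) fun _ h => h
  | or b c ihb ihc =>
    intro d σ hd h
    simp only [time, Polynomial.eval_add, Polynomial.eval_ofNat, add_assoc]
    refine (ihb hd h).seq fun σ₁ h₁ => Ensures.mono (Ensures.ite
      (K := c.time.eval (n + m) + 1) (fun hb => ?_) (fun hb => ?_)) (by omega) fun _ h => h
    all_goals simp only [Test.Holds, h₁.1.one, h₁.2.2] at hb
    · have : b.Holds n m s := by by_contra h; simp [h] at hb
      simp only [this, if_true] at h₁
      simp only [Holds, this, true_or, if_true]
      exact (Ensures.skip h₁).mono (by omega) fun _ h => h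
    · have : ¬ b.Holds n m s := by intro h; simp [h] at hb
      simp only [Holds, this, false_or]
      exact (ihc hd h₁.1).mono (by omega) fun σ' h' => ⟨h'.1, h₁.2.1.trans h'.2.1, h'.2.2⟩

/-- The invariant after `i` passes is simulation of the `i`-fold iterate. The body keeps temporaries
below `d + 1`, which includes the counter. -/
theorem iter_spec {f : State → State} {x b B d K : ℕ} {p : Prog} (hd : 4 ≤ d)
    (hb' : ∀ s σ, Sim n m s σ → σ.reg b = B)
    (hp : ∀ s σ, Sim n m s σ →
      Ensures p σ K (fun σ' => Sim n m (f s) σ' ∧ Keep (d + 1) σ σ'))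
    (h : Sim n m s σ) :
    Ensures (.count (2 * d + 1) b (.seq (.instr (.sub (2 * x) (2 * d + 1) 5)) p)) σ
      (B * (K + 3) + 2) (fun σ' => Sim n m (iter x f B s) σ' ∧ Keep d σ σ') := by
  refine Ensures.mono (Ensures.count (K := 1 + K)
    (fun i σ' => Sim n m (iter x f i s) σ' ∧ Keep d σ σ') (fun i σ h => hb' _ _ h.1)
    (fun i σ h => h.1.one) ?_ ?_ ⟨h, Keep.refl _ _⟩)
    (by rw [show 1 + K + 2 = K + 3 by omega]) fun _ h => h
  · rintro i τ v ⟨h1, h2⟩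
    exact ⟨h1.setTemp hd v, h2.trans (Keep.setReg _ _ le_rfl v)⟩
  · rintro i τ hi ⟨h1, h2⟩ hc
    refine Ensures.seq (Q := fun σ' => σ' = τ.setReg (2 * x) i) (Ensures.instr ?_) ?_
    · simp [Instr.run, State.setReg, hc, h1.one]
    · rintro _ rfl
      refine (hp _ _ (h1.setReg x i)).mono le_rfl fun σ' h' => ⟨⟨h'.1, ?_⟩, ?_⟩
      · have hk : Keep d τ (τ.setReg (2 * x) i) := fun j _ =>
          ⟨State.setReg_reg_of_ne _ _ (by omega), rfl⟩
        exact h2.trans (hk.trans (h'.2.mono (Nat.le_succ d)))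
      · rw [(h'.2 d (by omega)).1, State.setReg_reg_of_ne _ _ (by omega), hc]

theorem Cmd.comp_spec (c : Cmd) : ∀ {d : ℕ} {s σ : State}, 4 ≤ d → Sim n m s σ →
    Ensures (c.comp d) σ (c.time.eval (n + m))
      (fun σ' => Sim n m (c.den n m s) σ' ∧ Keep d σ σ') := by
  induction c with
  | set x e =>
    intro d s σ hd h
    simp only [time, Polynomial.eval_add, Polynomial.eval_one]
    refine (e.comp_spec hd h).seq fun σ₁ h₁ => Ensures.instr ⟨?_, ?_⟩
    · have := h₁.1.setReg x (e.eval n m s)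
      simpa [Instr.run, State.setReg, h₁.2.2, h₁.1.zero, den] using this
    · exact h₁.2.1.trans fun j hj => ⟨State.setReg_reg_of_ne _ _ (by omega), rfl⟩
  | store a i e =>
    intro d s σ hd h
    simp only [time, Polynomial.eval_add, Polynomial.eval_one, add_assoc]
    refine (i.comp_spec hd h).seq fun σ₁ h₁ => (e.comp_spec (d := d + 1) (by omega) h₁.1).seq
      fun σ₂ h₂ => Ensures.instr ⟨?_, ?_⟩
    · obtain ⟨h1, h2, h3⟩ := h₂
      refine ⟨h1.reg, ?_, h1.rreg, h1.rmem, h1.dimM, h1.dimN, h1.one, h1.zero, h1.rzero⟩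
      simp only [Instr.run, den, h3, (h2 d (by omega)).1, h₁.2.2, h1.mem]
    · exact h₁.2.1.trans (h₂.2.1.mono (by omega))
  | rset x e =>
    intro d s σ hd h
    simp only [time, Polynomial.eval_add, Polynomial.eval_one]
    refine (e.comp_spec hd h).seq fun σ₁ h₁ => Ensures.instr ⟨?_, ?_⟩
    · have := h₁.1.setRreg x (e.eval n m s)
      simpa [Instr.run, State.setRreg, h₁.2.2, h₁.1.rzero, den] using this
    · exact h₁.2.1.trans fun j hj => ⟨rfl, Function.update_of_ne (by omega) _ _⟩
  | rstore a i e =>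
    intro d s σ hd h
    simp only [time, Polynomial.eval_add, Polynomial.eval_one, add_assoc]
    refine (i.comp_spec hd h).seq fun σ₁ h₁ => (e.comp_spec (d := d + 1) (by omega) h₁.1).seq
      fun σ₂ h₂ => Ensures.instr ⟨?_, ?_⟩
    · obtain ⟨h1, h2, h3⟩ := h₂
      refine ⟨h1.reg, h1.mem, h1.rreg, ?_, h1.dimM, h1.dimN, h1.one, h1.zero, h1.rzero⟩
      simp only [Instr.run, den, h3, (h2 d (by omega)).1, h₁.2.2, h1.rmem]
    · exact h₁.2.1.trans (h₂.2.1.mono (by omega))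
  | seq p q ihp ihq =>
    intro d s σ hd h
    simp only [time, Polynomial.eval_add]
    exact (ihp hd h).seq fun σ₁ h₁ => (ihq hd h₁.1).mono le_rfl
      fun σ₂ h₂ => ⟨h₂.1, h₁.2.trans h₂.2⟩
  | when c p ih =>
    intro d s σ hd h
    simp only [time, Polynomial.eval_add, Polynomial.eval_ofNat, add_assoc]
    refine (c.comp_spec hd h).seq fun σ₁ h₁ => Ensures.mono (Ensures.ite
      (K := p.time.eval (n + m) + 1) (fun hb => ?_) (fun hb => ?_)) (by omega) fun _ h => h
    all_goals simp only [Test.Holds, h₁.1.one, h₁.2.2] at hb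
    · have : c.Holds n m s := by by_contra h; simp [h] at hb
      simp only [den, this, if_true]
      exact (ih hd h₁.1).mono (by omega) fun σ' h' => ⟨h'.1, h₁.2.1.trans h'.2⟩
    · have : ¬ c.Holds n m s := by intro h; simp [h] at hb
      simp only [den, this, if_false]
      exact (Ensures.skip ⟨h₁.1, h₁.2.1⟩).mono (by omega) fun _ h => h
  | forN x p ih =>
    intro d s σ hd h
    simp only [time, Polynomial.eval_add, Polynomial.eval_mul, Polynomial.eval_X,
      Polynomial.eval_ofNat]
    exact (iter_spec hd (fun _ _ h => h.dimN) (fun _ _ h => ih (by omega) h) h).mono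
      (by gcongr; omega) fun _ h => h
  | forM x p ih =>
    intro d s σ hd h
    simp only [time, Polynomial.eval_add, Polynomial.eval_mul, Polynomial.eval_X,
      Polynomial.eval_ofNat]
    exact (iter_spec hd (fun _ _ h => h.dimM) (fun _ _ h => ih (by omega) h) h).mono
      (by gcongr; omega) fun _ h => h

/-- The source configuration in which a compiled command starts. -/
noncomputable def source {n m : ℕ} (G : WHypergraph n m) (S : Finset (Fin n)) : State :=
  { input G S with reg := fun x => (input G S).reg (2 * x) }

/-- Load the constants, then run the compiled command. -/
def Cmd.prog (c : Cmd) : Prog :=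
  .seq (.instr (.add 3 0 7)) (.seq (.instr (.const 5 1)) (c.comp 4))

/-- The input already has `m` in register `1` and zeros in register `7` and real register `1`, so
only registers `3` and `5` need loading; this accounts for the two extra steps. Depth `4` is the
first whose temporaries avoid the constants. -/
theorem Cmd.prog_spec (c : Cmd) (G : WHypergraph n m) (S : Finset (Fin n)) :
    Ensures c.prog (input G S) ((c.time + 2).eval (n + m))
      (Sim n m (c.den n m (source G S))) := by
  refine Ensures.mono (Ensures.seq (Q := fun σ' => σ' = (input G S).setReg 3 n)
    (Ensures.instr ?_) ?_) (K := 1 + (1 + c.time.eval (n + m))) ?_ (fun _ h => h)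
  · simp [Instr.run, State.setReg, input]
  · rintro _ rfl
    refine Ensures.seq (Q := fun σ' => σ' = ((input G S).setReg 3 n).setReg 5 1)
      (Ensures.instr rfl) ?_
    rintro _ rfl
    refine (c.comp_spec le_rfl ?_).mono le_rfl fun _ h => h.1
    refine ⟨fun x => ?_, rfl, fun x => rfl, rfl, rfl, rfl, rfl, rfl, rfl⟩
    rw [State.setReg_reg_of_ne _ _ (by omega), State.setReg_reg_of_ne _ _ (by omega)]
    rfl
  · simp only [Polynomial.eval_add, Polynomial.eval_ofNat]; omega

end RAM

namespace WHypergraph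

open Finset

open scoped Classical

variable {n m : ℕ} (G : WHypergraph n m)

/-! ### Connectivity -/

/-- `u` and `v` are joined by a path in `t`. -/
def Reach (t : Finset (Fin m)) : Fin n → Fin n → Prop :=
  Relation.ReflTransGen fun a b => ∃ e ∈ t, a ∈ G.edge e ∧ b ∈ G.edge e

variable {G}

theorem mem_span {t : Finset (Fin m)} {v : Fin n} : v ∈ G.span t ↔ ∃ e ∈ t, v ∈ G.edge e := by
  simp [span]

theorem span_mono {t t' : Finset (Fin m)} (h : t ⊆ t') : G.span t ⊆ G.span t' :=
  biUnion_subset_biUnion_of_subset_left _ h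

theorem Reach.mono {t t' : Finset (Fin m)} (h : t ⊆ t') {u v : Fin n} (hr : G.Reach t u v) :
    G.Reach t' u v :=
  Relation.ReflTransGen.mono (fun _ _ ⟨e, he, h'⟩ => ⟨e, h he, h'⟩) _ _ hr

theorem Reach.symm {t : Finset (Fin m)} {u v : Fin n} (hr : G.Reach t u v) : G.Reach t v u := by
  induction hr with
  | refl => exact .refl
  | tail _ h ih =>
    obtain ⟨e, he, h1, h2⟩ := h
    exact .head ⟨e, he, h2, h1⟩ ih

theorem Reach.of_edge {t : Finset (Fin m)} {e : Fin m} (he : e ∈ t) {u v : Fin n}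
    (hu : u ∈ G.edge e) (hv : v ∈ G.edge e) : G.Reach t u v :=
  .single ⟨e, he, hu, hv⟩

theorem Reach.mem_span {t : Finset (Fin m)} {u v : Fin n} (hr : G.Reach t u v)
    (hv : v ∈ G.span t) : u ∈ G.span t := by
  rcases hr.cases_head with rfl | ⟨_, ⟨e, he, hu, _⟩, _⟩
  · exact hv
  · exact WHypergraph.mem_span.2 ⟨e, he, hu⟩

variable (G)

/-- `G.Chain v Q e`: there is a sequence of distinct hyperedges, consecutive ones meeting, that
starts with a hyperedge containing `v`, runs through the members of `Q` and ends with `e`; the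
last hyperedge `e` may also be a member of `Q`. -/
inductive Chain (v : Fin n) : Finset (Fin m) → Fin m → Prop where
  | start {e : Fin m} : v ∈ G.edge e → Chain v ∅ e
  | step {Q : Finset (Fin m)} {f e : Fin m} {u : Fin n} : Chain v Q f → f ∉ Q →
      u ∈ G.edge f → u ∈ G.edge e → Chain v (insert f Q) e

variable {G}

/-- Cut the chain off at the occurrence of `g`. -/
theorem Chain.exists_of_mem {v : Fin n} {Q : Finset (Fin m)} {e g : Fin m} (h : G.Chain v Q e)
    (hg : g ∈ Q) : ∃ Q' ⊆ Q, G.Chain v Q' g ∧ g ∉ Q' := by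
  induction h with
  | start => simp at hg
  | @step Q f e u h hf _ _ ih =>
    rcases mem_insert.1 hg with rfl | hg
    · exact ⟨Q, subset_insert _ _, h, hf⟩
    · obtain ⟨Q', h1, h2⟩ := ih hg
      exact ⟨Q', h1.trans (subset_insert _ _), h2⟩

/-- Loop erasure: when the next hyperedge of the walk already occurs in the chain, the chain is cut
back to it. Distinctness makes the sum over the set `Q` equal to the length of the chain. -/
theorem Reach.exists_chain {t : Finset (Fin m)} {u v : Fin n} (hv : v ∈ G.span t)
    (hr : G.Reach t v u) : ∃ Q ⊆ t, ∃ e ∈ t, G.Chain v Q e ∧ e ∉ Q ∧ u ∈ G.edge e := by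
  induction hr with
  | refl =>
    obtain ⟨e, he, h⟩ := WHypergraph.mem_span.1 hv
    exact ⟨∅, empty_subset _, e, he, .start h, notMem_empty _, h⟩
  | tail _ h ih =>
    obtain ⟨Q, hQ, e, he, hc, heQ, hu⟩ := ih
    obtain ⟨g, hg, h1, h2⟩ := h
    by_cases hgQ : g ∈ insert e Q
    · rcases mem_insert.1 hgQ with rfl | hgQ
      · exact ⟨Q, hQ, g, hg, hc, heQ, h2⟩
      · obtain ⟨Q', hQ', hc', hg'⟩ := hc.exists_of_mem hgQ
        exact ⟨Q', hQ'.trans hQ, g, hg, hc', hg', h2⟩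
    · exact ⟨insert e Q, insert_subset he hQ, g, hg, .step hc heQ hu h1, hgQ, h2⟩

/-! ### Tables of distances and stars -/

/-- For every hyperedge `e` and node `v`: whether a path from `v` to `e` is known, its length
(not counting `e`), and its hyperedges. -/
@[ext]
structure Table (n m : ℕ) where
  known : Fin m → Fin n → Prop
  dist : Fin m → Fin n → ℝ
  path : Fin m → Fin n → Finset (Fin m)

variable (G)

/-- The set `t` of hyperedges contains `e`, is connected and contains `v`. -/
structure Joins (e : Fin m) (v : Fin n) (t : Finset (Fin m)) : Prop where
  mem : e ∈ t
  nonempty : (G.edge e).Nonempty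
  mem_span : v ∈ G.span t
  reach : ∀ u ∈ G.span t, G.Reach t u v

/-- The table contains shortest paths with respect to the weights `w`. -/
structure Table.IsShortest (w : Fin m → ℝ) (A : Table n m) : Prop where
  joins : ∀ e v, A.known e v → G.Joins e v (insert e (A.path e v))
  sum_le : ∀ e v, A.known e v → ∑ f ∈ A.path e v, w f ≤ A.dist e v
  le_sum : ∀ e v Q, G.Chain v Q e → A.known e v ∧ A.dist e v ≤ ∑ f ∈ Q, w f

/-- The members of `R` at distance at most `dist e v₀` from `e`. -/
noncomputable def Table.ball (A : Table n m) (R : Finset (Fin n)) (e : Fin m) (v₀ : Fin n) :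
    Finset (Fin n) := R.filter fun v => A.known e v ∧ A.dist e v ≤ A.dist e v₀

/-- The weight of `e` and of the paths from `e` to its ball. -/
noncomputable def Table.starCost (A : Table n m) (w : Fin m → ℝ) (R : Finset (Fin n))
    (e : Fin m) (v₀ : Fin n) : ℝ := w e + ∑ v ∈ A.ball R e v₀, A.dist e v

/-- The stars that the greedy algorithm considers. -/
def Table.IsStar (A : Table n m) (R : Finset (Fin n)) (e : Fin m) (v₀ : Fin n) : Prop :=
  v₀ ∈ R ∧ A.known e v₀ ∧ (2 ≤ (A.ball R e v₀).card ∨ R.card ≤ 1)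

variable {G} {A : Table n m} {w : Fin m → ℝ} {R : Finset (Fin n)}

theorem Joins.start {e : Fin m} {v : Fin n} (h : v ∈ G.edge e) : G.Joins e v (insert e ∅) where
  mem := mem_insert_self _ _
  nonempty := ⟨v, h⟩
  mem_span := WHypergraph.mem_span.2 ⟨e, by simp, h⟩
  reach u hu := by
    obtain ⟨f, hf, huf⟩ := WHypergraph.mem_span.1 hu
    obtain rfl : f = e := by simpa using hf
    exact .of_edge (by simp) huf h

theorem Joins.step {e f : Fin m} {u v : Fin n} {t : Finset (Fin m)} (h : G.Joins f v t)
    (hf : u ∈ G.edge f) (he : u ∈ G.edge e) : G.Joins e v (insert e t) where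
  mem := mem_insert_self _ _
  nonempty := ⟨u, he⟩
  mem_span := span_mono (subset_insert _ _) h.mem_span
  reach x hx := by
    have key : ∀ y ∈ G.span t, G.Reach (insert e t) y v := fun y hy =>
      (h.reach y hy).mono (subset_insert _ _)
    obtain ⟨g, hg, hxg⟩ := WHypergraph.mem_span.1 hx
    rcases mem_insert.1 hg with rfl | hg
    · exact (Reach.of_edge (mem_insert_self _ _) hxg he).trans
        (key u (WHypergraph.mem_span.2 ⟨f, h.mem, hf⟩))
    · exact key x (WHypergraph.mem_span.2 ⟨g, hg, hxg⟩)

theorem Table.mem_ball {e : Fin m} {v v₀ : Fin n} :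
    v ∈ A.ball R e v₀ ↔ v ∈ R ∧ A.known e v ∧ A.dist e v ≤ A.dist e v₀ := by
  simp [ball]

theorem Table.ball_subset (e : Fin m) (v₀ : Fin n) : A.ball R e v₀ ⊆ R := filter_subset _ _

theorem Table.self_mem_ball {e : Fin m} {v₀ : Fin n} (h : v₀ ∈ R) (h' : A.known e v₀) :
    v₀ ∈ A.ball R e v₀ := mem_ball.2 ⟨h, h', le_rfl⟩

/-- The part of the weight of `e` within distance `δ` from `v`. -/
noncomputable def Table.charge (A : Table n m) (w : Fin m → ℝ) (δ : ℝ) (e : Fin m) (v : Fin n) :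
    ℝ := if A.known e v then min (w e) (max 0 (δ - A.dist e v)) else 0

theorem Table.charge_nonneg (hw : ∀ e, 0 ≤ w e) (δ : ℝ) (e : Fin m) (v : Fin n) :
    0 ≤ A.charge w δ e v := by
  unfold charge
  split_ifs
  · exact le_min (hw e) (le_max_left _ _)
  · exact le_rfl

/-- If every star with at least two feet has density at least `δ`, the nodes closer than `δ` to a
hyperedge form a star, and this bounds the sum of their distances to `δ`. -/
theorem Table.sum_sub_le {δ : ℝ}
    (hδ : ∀ e v₀, v₀ ∈ R → A.known e v₀ → 2 ≤ (A.ball R e v₀).card →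
      δ * (A.ball R e v₀).card ≤ A.starCost w R e v₀) (e : Fin m)
    (h2 : 2 ≤ (R.filter fun v => A.known e v ∧ A.dist e v < δ).card) :
    ∑ v ∈ R.filter (fun v => A.known e v ∧ A.dist e v < δ), (δ - A.dist e v) ≤ w e := by
  set B := R.filter fun v => A.known e v ∧ A.dist e v < δ with hB
  -- The farthest node of `B` serves as radius, which turns `B` into a ball and thus into the feet
  -- of a star.
  obtain ⟨v₀, hv₀, hmax⟩ := exists_max_image B (A.dist e) (card_pos.1 (by omega))
  have hv := (mem_filter.1 hv₀).2
  have hball : A.ball R e v₀ = B := by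
    ext v
    rw [mem_ball, hB, mem_filter]
    constructor
    · rintro ⟨h1, h3, h4⟩
      exact ⟨h1, h3, h4.trans_lt hv.2⟩
    · rintro ⟨h1, h3, h4⟩
      exact ⟨h1, h3, hmax v (mem_filter.2 ⟨h1, h3, h4⟩)⟩
  have := hδ e v₀ (mem_filter.1 hv₀).1 hv.1 (hball ▸ h2)
  rw [starCost, hball] at this
  rw [sum_sub_distrib, sum_const, nsmul_eq_mul, mul_comm]
  linarith

/-- Only nodes closer than `δ` contribute. Two or more of them are handled by the density
assumption; a single one is harmless because every charge is capped by `w e`. -/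
theorem Table.sum_charge_le (hw : ∀ e, 0 ≤ w e) {δ : ℝ}
    (hδ : ∀ e v₀, v₀ ∈ R → A.known e v₀ → 2 ≤ (A.ball R e v₀).card →
      δ * (A.ball R e v₀).card ≤ A.starCost w R e v₀) (e : Fin m) :
    ∑ v ∈ R, A.charge w δ e v ≤ w e := by
  set B := R.filter fun v => A.known e v ∧ A.dist e v < δ with hB
  have h1 : ∑ v ∈ R, A.charge w δ e v = ∑ v ∈ B, A.charge w δ e v := by
    refine (sum_subset (filter_subset _ _) fun v hv hvB => ?_).symm
    unfold charge
    split_ifs with hk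
    · have : δ ≤ A.dist e v := by
        by_contra h
        exact hvB (mem_filter.2 ⟨hv, hk, not_le.1 h⟩)
      rw [max_eq_left (by linarith), min_eq_right (hw e)]
    · rfl
  rw [h1]
  by_cases h2 : 2 ≤ B.card
  · refine le_trans (sum_le_sum fun v hv => ?_) (sum_sub_le hδ e h2)
    have hv := (mem_filter.1 hv).2
    rw [charge, if_pos hv.1, max_eq_right (by linarith)]
    exact min_le_right _ _
  · rcases eq_empty_or_nonempty B with h0 | ⟨v, hv⟩
    · simp [h0, hw e]
    · rw [card_eq_one.1 (show B.card = 1 by have := card_pos.2 ⟨v, hv⟩; omega) |>.choose_spec,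
        sum_singleton, charge]
      split_ifs
      · exact min_le_left _ _
      · exact hw e

/-- Along a chain from `v`, a hyperedge `f` occupies an interval of length `w f` that begins no
earlier than the recorded distance of `f`. Its charge therefore covers at least the part of that
interval below `δ`. -/
theorem Table.min_le_sum_charge (hA : A.IsShortest G w) (hw : ∀ e, 0 ≤ w e) (δ : ℝ)
    {v : Fin n} {Q : Finset (Fin m)} {e : Fin m} (h : G.Chain v Q e) :
    min δ (∑ f ∈ Q, w f) ≤ ∑ f ∈ Q, A.charge w δ f v := by
  induction h with
  | start => simp
  | @step Q f e u h hf _ _ ih =>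
    obtain ⟨h1, h2⟩ := hA.le_sum _ _ _ h
    rw [sum_insert hf, sum_insert hf, charge, if_pos h1]
    rcases le_total δ (∑ g ∈ Q, w g) with h3 | h3
    · rw [min_eq_left h3] at ih
      have : 0 ≤ min (w f) (max 0 (δ - A.dist f v)) := le_min (hw f) (le_max_left _ _)
      exact (min_le_left _ _).trans (by linarith)
    · rw [min_eq_right h3] at ih
      rw [max_eq_right (by linarith)]
      rcases le_total (w f) (δ - A.dist f v) with h4 | h4
      · rw [min_eq_left h4]
        exact (min_le_right _ _).trans (by linarith)
      · rw [min_eq_right h4]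
        exact (min_le_left _ _).trans (by linarith)

/-- A connected set of hyperedges containing at least two members of `R` weighs at least `δ` per
member of `R`, if all stars have density at least `δ`. -/
theorem Table.density_le (hA : A.IsShortest G w) (hw : ∀ e, 0 ≤ w e) {δ : ℝ}
    (hδ : ∀ e v₀, v₀ ∈ R → A.known e v₀ → 2 ≤ (A.ball R e v₀).card →
      δ * (A.ball R e v₀).card ≤ A.starCost w R e v₀)
    {t : Finset (Fin m)} (ht : G.IsConn t) (hR : R ⊆ G.span t) (h2 : 2 ≤ R.card) :
    δ * R.card ≤ ∑ e ∈ t, w e := by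
  have key : ∀ v ∈ R, δ ≤ ∑ e ∈ t, A.charge w δ e v := by
    intro v hv
    obtain ⟨v', hv', hne⟩ := exists_mem_ne (show 1 < R.card by omega) v
    obtain ⟨Q, hQ, e, he, hc, heQ, hve⟩ :=
      Reach.exists_chain (hR hv) (ht v (hR hv) v' (hR hv'))
    -- Stepping from `e` to `e` itself brings the weight of the last hyperedge into the sum; this is
    -- why the end of a chain may belong to `Q`.
    have hstep : G.Chain v (insert e Q) e := .step hc heQ hve hve
    have h1 := min_le_sum_charge hA hw δ hstep
    have h3 : ∑ f ∈ insert e Q, A.charge w δ f v ≤ ∑ f ∈ t, A.charge w δ f v :=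
      sum_le_sum_of_subset_of_nonneg (insert_subset he hQ) fun _ _ _ => charge_nonneg hw _ _ _
    refine le_trans ?_ (h1.trans h3)
    -- If the chain weighed less than `δ`, both `v` and `v'` would be closer than `δ` to `e`, the
    -- latter at distance at most zero. The two differences `δ - dist` then sum to at most `w e`, so
    -- `2 * δ` is at most the weight of the chain, contradicting `0 ≤ weight < δ`.
    refine le_min le_rfl (le_of_not_gt fun hlt => ?_)
    rw [sum_insert heQ] at hlt
    obtain ⟨k1, d1⟩ := hA.le_sum _ _ _ hc
    obtain ⟨k2, d2⟩ := hA.le_sum _ _ _ (.start hve)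
    rw [sum_empty] at d2
    have hwe := hw e
    have hQ0 : 0 ≤ ∑ f ∈ Q, w f := sum_nonneg fun f _ => hw f
    have hsub : {v, v'} ⊆ R.filter fun v => A.known e v ∧ A.dist e v < δ := by
      intro x hx
      rcases mem_insert.1 hx with rfl | hx
      · exact mem_filter.2 ⟨hv, k1, by linarith⟩
      · rw [mem_singleton.1 hx]
        exact mem_filter.2 ⟨hv', k2, by linarith⟩
    have h4 := sum_sub_le hδ e ((card_pair hne.symm).symm.le.trans (card_le_card hsub))
    have h5 : ∑ x ∈ {v, v'}, (δ - A.dist e x) ≤ _ :=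
      sum_le_sum_of_subset_of_nonneg hsub fun x hx _ => by
        have := (mem_filter.1 hx).2.2
        linarith
    rw [sum_pair hne.symm] at h5
    linarith
  calc δ * R.card = ∑ v ∈ R, δ := by rw [sum_const, nsmul_eq_mul, mul_comm]
    _ ≤ ∑ v ∈ R, ∑ e ∈ t, A.charge w δ e v := sum_le_sum key
    _ = ∑ e ∈ t, ∑ v ∈ R, A.charge w δ e v := sum_comm
    _ ≤ ∑ e ∈ t, w e := sum_le_sum fun e _ => sum_charge_le hw hδ e

/-- With two representatives `v`, `v'` left, the last hyperedge of a chain from `v` to `v'` knows a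
path to both. Taking the farthest known representative as radius puts both into the ball. -/
theorem Table.exists_isStar (hA : A.IsShortest G w) {t : Finset (Fin m)} (ht : G.IsConn t)
    (hR : R ⊆ G.span t) (h0 : R.Nonempty) : ∃ e v₀, A.IsStar R e v₀ := by
  obtain ⟨v, hv⟩ := h0
  by_cases h1 : R.card ≤ 1
  · obtain ⟨e, _, he⟩ := mem_span.1 (hR hv)
    exact ⟨e, v, hv, (hA.le_sum _ _ _ (.start he)).1, .inr h1⟩
  · obtain ⟨v', hv', hne⟩ := exists_mem_ne (show 1 < R.card by omega) v
    obtain ⟨Q, _, e, _, hc, _, hve⟩ := Reach.exists_chain (hR hv) (ht v (hR hv) v' (hR hv'))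
    have k1 := (hA.le_sum _ _ _ hc).1
    have k2 := (hA.le_sum _ _ _ (.start hve)).1
    obtain ⟨v₀, hv₀, hmax⟩ := exists_max_image (R.filter (A.known e)) (A.dist e)
      ⟨v, mem_filter.2 ⟨hv, k1⟩⟩
    refine ⟨e, v₀, (mem_filter.1 hv₀).1, (mem_filter.1 hv₀).2, .inl ?_⟩
    rw [← card_pair hne.symm]
    refine card_le_card fun x hx => ?_
    rcases mem_insert.1 hx with rfl | hx
    · exact mem_ball.2 ⟨hv, k1, hmax _ (mem_filter.2 ⟨hv, k1⟩)⟩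
    · rw [mem_singleton.1 hx]
      exact mem_ball.2 ⟨hv', k2, hmax _ (mem_filter.2 ⟨hv', k2⟩)⟩

/-! ### The greedy algorithm -/

/-- The weights that remain after the hyperedges in `t` have been bought. -/
noncomputable def residual (G : WHypergraph n m) (t : Finset (Fin m)) (e : Fin m) : ℝ :=
  if e ∈ t then 0 else G.weight e

theorem residual_nonneg (t : Finset (Fin m)) (e : Fin m) : 0 ≤ G.residual t e := by
  unfold residual
  split_ifs
  · exact le_rfl
  · exact G.weight_nonneg e

theorem residual_le (t : Finset (Fin m)) (e : Fin m) : G.residual t e ≤ G.weight e := by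
  unfold residual
  split_ifs
  · exact G.weight_nonneg e
  · exact le_rfl

theorem sum_biUnion_le_of_nonneg {ι κ : Type*} [DecidableEq κ] {f : κ → ℝ} (hf : ∀ i, 0 ≤ f i) (s : Finset ι)
    (t : ι → Finset κ) : ∑ j ∈ s.biUnion t, f j ≤ ∑ i ∈ s, ∑ j ∈ t i, f j := by
  induction s using Finset.induction_on with
  | empty => simp
  | insert a s ha ih =>
    have h := sum_union_inter (s₁ := t a) (s₂ := s.biUnion t) (f := f)
    have h' : 0 ≤ ∑ j ∈ t a ∩ s.biUnion t, f j := sum_nonneg fun j _ => hf j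
    rw [biUnion_insert, sum_insert ha]
    linarith

theorem cost_union_le (t t' : Finset (Fin m)) :
    G.cost (t ∪ t') ≤ G.cost t + ∑ e ∈ t', G.residual t e := by
  have h : ∑ e ∈ t', G.residual t e = ∑ e ∈ t' \ t, G.weight e := by
    rw [← sum_inter_add_sum_sdiff t' t, sum_eq_zero (s := t' ∩ t), zero_add]
    · exact sum_congr rfl fun e he => if_neg (mem_sdiff.1 he).2
    · exact fun e he => if_pos (mem_inter.1 he).2
  rw [h, cost, cost, ← union_sdiff_self_eq_union, sum_union disjoint_sdiff]

/-- Buy the star of `e` and `v₀`. -/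
noncomputable def Table.buy (A : Table n m) (R : Finset (Fin n)) (e : Fin m) (v₀ : Fin n)
    (t : Finset (Fin m)) : Finset (Fin m) :=
  t ∪ insert e ((A.ball R e v₀).biUnion (A.path e))

/-- The representatives that remain after buying a star. -/
noncomputable def Table.shrink (A : Table n m) (R : Finset (Fin n)) (e : Fin m) (v₀ : Fin n) :
    Finset (Fin n) :=
  if 2 ≤ R.card then insert v₀ (R \ A.ball R e v₀) else R \ A.ball R e v₀

/-- Hyperedges shared by several paths, or already bought, only make the true cost smaller than the
sum of distances. -/
theorem Table.cost_buy_le {t : Finset (Fin m)} (hA : A.IsShortest G (G.residual t)) (e : Fin m)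
    (v₀ : Fin n) : G.cost (A.buy R e v₀ t) ≤ G.cost t + A.starCost (G.residual t) R e v₀ := by
  refine (cost_union_le _ _).trans (add_le_add_right ?_ _)
  have h1 : ∑ f ∈ insert e ((A.ball R e v₀).biUnion (A.path e)), G.residual t f ≤
      G.residual t e + ∑ f ∈ (A.ball R e v₀).biUnion (A.path e), G.residual t f := by
    by_cases h : e ∈ (A.ball R e v₀).biUnion (A.path e)
    · rw [insert_eq_of_mem h]
      linarith [residual_nonneg (G := G) t e]
    · rw [sum_insert h]
  refine h1.trans (add_le_add_right ?_ _)
  exact (sum_biUnion_le_of_nonneg (residual_nonneg t) _ _).trans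
    (sum_le_sum fun v hv => hA.sum_le e v (mem_ball.1 hv).2.1)

variable (G) in
/-- Every member of `S` and every node of `t` is joined in `t` to a representative; once there
is no representative left, `t` is a solution. -/
def Progress (S : Finset (Fin n)) (t : Finset (Fin m)) (R : Finset (Fin n)) : Prop :=
  R ⊆ S ∧ (R.Nonempty → ∀ u ∈ S ∪ G.span t, ∃ r ∈ R, G.Reach t u r) ∧
    (R = ∅ → t ∈ G.steinerSets S)

theorem Progress.init (S : Finset (Fin n)) : G.Progress S ∅ S := by
  refine ⟨Subset.rfl, fun _ u hu => ⟨u, ?_, .refl⟩, ?_⟩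
  · simpa [span] using hu
  · rintro rfl
    refine ⟨fun u hu => ?_, by simp⟩
    simp [span] at hu

/-- All feet become joined to `v₀` through the center `e`, so a foot can be replaced by `v₀`
everywhere. If `R` was just `{v₀}`, everything is now joined to `v₀` and `v₀` is covered, which is
the definition of a solution. -/
theorem Progress.step {S : Finset (Fin n)} {t : Finset (Fin m)} (h : G.Progress S t R)
    (hA : A.IsShortest G w) {e : Fin m} {v₀ : Fin n} (hs : A.IsStar R e v₀) :
    G.Progress S (A.buy R e v₀ t) (A.shrink R e v₀) := by
  obtain ⟨hv₀, hk, hcard⟩ := hs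
  obtain ⟨hRS, h1, -⟩ := h
  replace h1 := h1 ⟨v₀, hv₀⟩
  have hb := Table.self_mem_ball hv₀ hk
  set t' := A.buy R e v₀ t with ht'
  have hsub : ∀ v ∈ A.ball R e v₀, insert e (A.path e v) ⊆ t' := fun v hv =>
    (insert_subset_insert _ (subset_biUnion_of_mem (A.path e) hv)).trans subset_union_right
  have hj : ∀ v ∈ A.ball R e v₀, G.Joins e v (insert e (A.path e v)) := fun v hv =>
    hA.joins e v (Table.mem_ball.1 hv).2.1
  have hbr : ∀ v ∈ A.ball R e v₀, G.Reach t' v v₀ := by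
    intro v hv
    -- A node of the center is needed as a meeting point of the paths; an empty hyperedge would
    -- connect nothing.
    obtain ⟨x, hx⟩ := (hj v hv).nonempty
    have := fun v' (hv' : v' ∈ A.ball R e v₀) =>
      ((hj v' hv').reach x (mem_span.2 ⟨e, (hj v' hv').mem, hx⟩)).mono (hsub v' hv')
    exact (this v hv).symm.trans (this v₀ hb)
  have hreach : ∀ u ∈ S ∪ G.span t', ∃ r ∈ insert v₀ (R \ A.ball R e v₀), G.Reach t' u r := by
    have hold : ∀ u ∈ S ∪ G.span t, ∃ r ∈ insert v₀ (R \ A.ball R e v₀), G.Reach t' u r := by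
      intro u hu
      obtain ⟨r, hr, hur⟩ := h1 u hu
      replace hur := hur.mono (show t ⊆ t' from subset_union_left)
      by_cases hrb : r ∈ A.ball R e v₀
      · exact ⟨v₀, mem_insert_self _ _, hur.trans (hbr r hrb)⟩
      · exact ⟨r, mem_insert_of_mem (mem_sdiff.2 ⟨hr, hrb⟩), hur⟩
    intro u hu
    rcases mem_union.1 hu with hu | hu
    · exact hold u (mem_union_left _ hu)
    obtain ⟨g, hg, hug⟩ := mem_span.1 hu
    rcases mem_union.1 hg with hg | hg
    · exact hold u (mem_union_right _ (mem_span.2 ⟨g, hg, hug⟩))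
    obtain ⟨v, hv, hgv⟩ : ∃ v ∈ A.ball R e v₀, g ∈ insert e (A.path e v) := by
      rcases mem_insert.1 hg with rfl | hg
      · exact ⟨v₀, hb, mem_insert_self _ _⟩
      · obtain ⟨v, hv, hgv⟩ := mem_biUnion.1 hg
        exact ⟨v, hv, mem_insert_of_mem hgv⟩
    exact ⟨v₀, mem_insert_self _ _, (((hj v hv).reach u (mem_span.2 ⟨g, hgv, hug⟩)).mono
      (hsub v hv)).trans (hbr v hv)⟩
  unfold Table.shrink
  split_ifs with h2
  · refine ⟨insert_subset (hRS hv₀) (sdiff_subset.trans hRS), fun _ => hreach, fun h => ?_⟩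
    exact absurd h (insert_ne_empty _ _)
  · have hR : R = {v₀} := by
      obtain ⟨v, hv⟩ := card_eq_one.1 (show R.card = 1 by have := card_pos.2 ⟨v₀, hv₀⟩; omega)
      rw [hv] at hv₀ ⊢
      rw [mem_singleton.1 hv₀]
    have hball : R \ A.ball R e v₀ = ∅ := by
      rw [sdiff_eq_empty_iff_subset, hR]
      rw [hR] at hb
      exact singleton_subset_iff.2 hb
    rw [hball] at hreach ⊢
    have hreach' : ∀ u ∈ S ∪ G.span t', G.Reach t' u v₀ := fun u hu => by
      obtain ⟨r, hr, h⟩ := hreach u hu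
      rw [insert_empty, mem_singleton] at hr
      rwa [hr] at h
    refine ⟨empty_subset _, fun h => absurd h not_nonempty_empty, fun _ => ⟨?_, ?_⟩⟩
    · exact fun u hu v hv => (hreach' u (mem_union_right _ hu)).trans
        (hreach' v (mem_union_right _ hv)).symm
    · exact fun u hu => (hreach' u (mem_union_left _ hu)).mem_span
        (span_mono (hsub v₀ hb) (hj v₀ hb).mem_span)

/-- One foot is kept while another representative could remain, so `j` feet cost `j - 1`
representatives; the final single foot is dropped. -/
theorem Table.card_shrink {e : Fin m} {v₀ : Fin n} (hs : A.IsStar R e v₀) :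
    (2 ≤ (A.ball R e v₀).card ∧ (A.shrink R e v₀).card + (A.ball R e v₀).card = R.card + 1) ∨
    (R.card = 1 ∧ (A.shrink R e v₀).card = 0 ∧ (A.ball R e v₀).card = 1) := by
  obtain ⟨hv₀, hk, hcard⟩ := hs
  have hb := self_mem_ball hv₀ hk
  have h1 := card_sdiff_add_card_eq_card (A.ball_subset (R := R) e v₀)
  have h2 := card_le_card (A.ball_subset (R := R) e v₀)
  have h3 : 0 < (A.ball R e v₀).card := card_pos.2 ⟨v₀, hb⟩
  unfold shrink
  split_ifs with h
  · left
    rw [card_insert_of_notMem (by simp [hb])]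
    omega
  · right
    omega

/-- An upper bound for the approximation factor in terms of the number of Steiner nodes. -/
noncomputable def factor (k : ℕ) : ℝ := if k = 0 then 0 else 2 * (harmonic k : ℝ) - 1

/-- The harmonic numbers differ by `j - 1` terms, each at least `1 / k`. The factor `2` pays for
replacing `j - 1` by `j`. -/
theorem div_le_factor_sub {k j : ℕ} (hj : 2 ≤ j) (hk : j ≤ k) :
    (j : ℝ) / k ≤ factor k - factor (k + 1 - j) := by
  have key : ∀ a i : ℕ, 0 < a + i → (i : ℝ) / ((a + i : ℕ) : ℝ) ≤
      (harmonic (a + i) : ℝ) - harmonic a := by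
    intro a i
    induction i with
    | zero => simp
    | succ i ih =>
      intro _
      rw [← add_assoc, harmonic_succ]
      rcases Nat.eq_zero_or_pos (a + i) with h0 | h0
      · obtain ⟨rfl, rfl⟩ : a = 0 ∧ i = 0 := by omega
        simp
      have h := ih h0
      have h1 : (i : ℝ) / ((a + i + 1 : ℕ) : ℝ) ≤ (i : ℝ) / ((a + i : ℕ) : ℝ) := by
        exact div_le_div_of_nonneg_left (by positivity) (by exact_mod_cast h0)
          (by exact_mod_cast Nat.le_succ _)
      push_cast at h h1 ⊢
      rw [add_div, one_div]
      linarith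
  have h := key (k + 1 - j) (j - 1) (by omega)
  rw [show k + 1 - j + (j - 1) = k by omega] at h
  have hk0 : (0 : ℝ) < k := by exact_mod_cast (by omega : 0 < k)
  rw [factor, factor, if_neg (by omega), if_neg (by omega)]
  have h2 : (j : ℝ) / k ≤ 2 * (((j - 1 : ℕ) : ℝ) / k) := by
    rw [← mul_div_assoc]
    gcongr
    have : j ≤ 2 * (j - 1) := by omega
    exact_mod_cast this
  linarith

/-- For `k ≥ 2` the harmonic bound gives `1 + 2 * log k`, and `1 ≤ 2 * log 2` absorbs the constant.
-/
theorem factor_le (k : ℕ) : factor k ≤ max 1 (4 * Real.log k) := by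
  unfold factor
  split_ifs with h
  · exact le_max_of_le_left zero_le_one
  · rcases Nat.lt_or_ge k 2 with h1 | h1
    · obtain rfl : k = 1 := by omega
      refine le_max_of_le_left ?_
      norm_num [harmonic]
    · refine le_max_of_le_right ?_
      have h2 := harmonic_le_one_add_log k
      have h3 : Real.log 2 ≤ Real.log k := Real.log_le_log (by norm_num) (by exact_mod_cast h1)
      have := Real.log_two_gt_d9
      linarith

/-- Buying the star of least density costs at most the decrease of `factor` times the optimum. -/
theorem Table.starCost_le {t : Finset (Fin m)} (hA : A.IsShortest G (G.residual t))
    {e : Fin m} {v₀ : Fin n} (hs : A.IsStar R e v₀)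
    (hmin : ∀ e' v', A.IsStar R e' v' →
      A.starCost (G.residual t) R e v₀ / (A.ball R e v₀).card ≤
        A.starCost (G.residual t) R e' v' / (A.ball R e' v').card)
    {u : Finset (Fin m)} (hu : G.IsConn u) (hR : R ⊆ G.span u) :
    A.starCost (G.residual t) R e v₀ ≤
      (factor R.card - factor (A.shrink R e v₀).card) * G.cost u := by
  have hres : ∑ f ∈ u, G.residual t f ≤ G.cost u := sum_le_sum fun f _ => residual_le t f
  have hcost : 0 ≤ G.cost u := sum_nonneg fun f _ => G.weight_nonneg f
  rcases card_shrink hs with ⟨h1, h2⟩ | ⟨h1, h2, h3⟩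
  · have hle := card_le_card (A.ball_subset (R := R) e v₀)
    -- The least density itself is the threshold `δ`; its hypothesis on all other stars is exactly
    -- `hmin`.
    have hd := density_le (δ := A.starCost (G.residual t) R e v₀ / (A.ball R e v₀).card)
      hA (residual_nonneg t) (fun e' v' h3 h4 h5 => ?_) hu hR (by omega)
    · have hk0 : (0 : ℝ) < R.card := by exact_mod_cast (by omega : 0 < R.card)
      have hj0 : (0 : ℝ) < (A.ball R e v₀).card := by
        exact_mod_cast (by omega : 0 < (A.ball R e v₀).card)
      have h6 := div_le_factor_sub h1 hle
      rw [show R.card + 1 - (A.ball R e v₀).card = (A.shrink R e v₀).card by omega] at h6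
      refine le_trans ?_ (mul_le_mul_of_nonneg_right h6 hcost)
      rw [div_mul_eq_mul_div, div_le_iff₀ hj0] at hd
      rw [div_mul_eq_mul_div, le_div_iff₀ hk0, mul_comm ((A.ball R e v₀).card : ℝ)]
      exact hd.trans (mul_le_mul_of_nonneg_right hres hj0.le)
    · have hj0 : (0 : ℝ) < (A.ball R e' v').card := by
        exact_mod_cast (by omega : 0 < (A.ball R e' v').card)
      rw [← le_div_iff₀ hj0]
      exact hmin e' v' ⟨h3, h4, .inl h5⟩
  -- For the last representative, compare with the star consisting of one hyperedge of `u` that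
  -- contains it; its cost is at most that of `u`, matching `factor 1 - factor 0 = 1`.
  · obtain ⟨f, hf, hv⟩ := mem_span.1 (hR hs.1)
    obtain ⟨hk, hd⟩ := hA.le_sum _ _ _ (.start hv)
    have hstar : A.IsStar R f v₀ := ⟨hs.1, hk, .inr h1.le⟩
    have h4 := hmin f v₀ hstar
    have h5 : (A.ball R f v₀).card = 1 := by
      have := card_shrink hstar
      have := card_le_card (A.ball_subset (R := R) f v₀)
      omega
    have h6 : A.ball R f v₀ = {v₀} := by
      obtain ⟨x, hx⟩ := card_eq_one.1 h5
      have := self_mem_ball hs.1 hk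
      rw [hx] at this ⊢
      rw [mem_singleton.1 this]
    rw [h3, h5, Nat.cast_one, div_one, div_one] at h4
    refine h4.trans ?_
    rw [starCost, h6, sum_singleton, h1, h2]
    rw [sum_empty] at hd
    have h7 : G.residual t f ≤ ∑ f ∈ u, G.residual t f :=
      single_le_sum (fun f _ => residual_nonneg t f) hf
    have : factor 1 - factor 0 = 1 := by norm_num [factor, harmonic]
    rw [this]
    linarith

end WHypergraph

namespace RAM

/-! ### Reasoning about commands -/

namespace Cmd

/-- The integer registers that a command may change. -/
def regs : Cmd → List ℕ
  | set x _ => [x]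
  | store _ _ _ | rset _ _ | rstore _ _ _ => []
  | seq p q => p.regs ++ q.regs
  | when _ p => p.regs
  | forN x p | forM x p => x :: p.regs

/-- The integer arrays that a command may change. -/
def arrays : Cmd → List ℕ
  | store a _ _ => [a]
  | set _ _ | rset _ _ | rstore _ _ _ => []
  | seq p q => p.arrays ++ q.arrays
  | when _ p | forN _ p | forM _ p => p.arrays

/-- The real registers that a command may change. -/
def rregs : Cmd → List ℕ
  | rset x _ => [x]
  | set _ _ | store _ _ _ | rstore _ _ _ => []
  | seq p q => p.rregs ++ q.rregs
  | when _ p | forN _ p | forM _ p => p.rregs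

/-- The real arrays that a command may change. -/
def rarrays : Cmd → List ℕ
  | rstore a _ _ => [a]
  | set _ _ | store _ _ _ | rset _ _ => []
  | seq p q => p.rarrays ++ q.rarrays
  | when _ p | forN _ p | forM _ p => p.rarrays

end Cmd

theorem iter_induction {f : State → State} {x b : ℕ} {s : State} (I : ℕ → State → Prop)
    (h0 : I 0 s) (hs : ∀ i s', i < b → I i s' → I (i + 1) (f (s'.setReg x i))) :
    I b (iter x f b s) := by
  have key : ∀ i ≤ b, I i (iter x f i s) := by
    intro i
    induction i with
    | zero => exact fun _ => h0
    | succ i ih => exact fun hi => hs i _ (by omega) (ih (by omega))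
  exact key b le_rfl

/-- A loop whose body moves up in a preorder and establishes in step `i` a property `Q i` that is
inherited upwards. -/
theorem iter_collect {f : State → State} {x b : ℕ} {s : State} (r : State → State → Prop)
    (hrefl : ∀ s, r s s) (htrans : ∀ s₁ s₂ s₃, r s₁ s₂ → r s₂ s₃ → r s₁ s₃)
    (Q : ℕ → State → Prop) (hQ : ∀ i s₁ s₂, r s₁ s₂ → Q i s₁ → Q i s₂)
    (hs : ∀ i s', i < b → r s s' → r s' (f (s'.setReg x i)) ∧ Q i (f (s'.setReg x i))) :
    r s (iter x f b s) ∧ ∀ i < b, Q i (iter x f b s) := by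
  refine iter_induction (fun i s' => r s s' ∧ ∀ j < i, Q j s') ⟨hrefl s, by simp⟩ ?_
  rintro i s' hi ⟨h1, h2⟩
  obtain ⟨h3, h4⟩ := hs i s' hi h1
  refine ⟨htrans _ _ _ h1 h3, fun j hj => ?_⟩
  rcases Nat.lt_succ_iff_lt_or_eq.1 hj with hj | rfl
  · exact hQ _ _ _ h3 (h2 j hj)
  · exact h4

/-! ### Frame rules: what a command leaves unchanged -/

section Frame

variable {n m : ℕ}

/-- The condition is purely syntactic, so for concrete commands it is settled by `decide`. The next
three lemmas do the same for the other kinds of storage. -/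
theorem Cmd.den_reg (c : Cmd) {x : ℕ} : ∀ {s : State}, x ∉ c.regs →
    (c.den n m s).reg x = s.reg x := by
  induction c with
  | set y e => intro s h; exact State.setReg_reg_of_ne _ _ (by simpa [regs] using h)
  | store | rset | rstore => intros; rfl
  | seq p q ihp ihq =>
    intro s h
    simp only [regs, List.mem_append, not_or] at h
    exact (ihq h.2).trans (ihp h.1)
  | when c p ih =>
    intro s h
    simp only [den]
    split_ifs
    · exact ih h
    · rfl
  | forN y p ih | forM y p ih =>
    intro s h
    simp only [regs, List.mem_cons, not_or] at h
    refine iter_induction (fun _ s' => s'.reg x = s.reg x) rfl fun i s' _ h' => ?_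
    rw [ih h.2, State.setReg_reg_of_ne _ _ h.1, h']

theorem Cmd.den_mem (c : Cmd) {a : ℕ} : ∀ {s : State}, a ∉ c.arrays →
    (c.den n m s).mem a = s.mem a := by
  induction c with
  | store b i e => intro s h; exact Function.update_of_ne (by simpa [arrays] using h) _ _
  | set | rset | rstore => intros; rfl
  | seq p q ihp ihq =>
    intro s h
    simp only [arrays, List.mem_append, not_or] at h
    exact (ihq h.2).trans (ihp h.1)
  | when c p ih =>
    intro s h
    simp only [den]
    split_ifs
    · exact ih h
    · rfl
  | forN y p ih | forM y p ih =>
    intro s h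
    refine iter_induction (fun _ s' => s'.mem a = s.mem a) rfl fun i s' _ h' => ?_
    rw [ih h, State.setReg, h']

theorem Cmd.den_rreg (c : Cmd) {x : ℕ} : ∀ {s : State}, x ∉ c.rregs →
    (c.den n m s).rreg x = s.rreg x := by
  induction c with
  | rset y e => intro s h; exact Function.update_of_ne (by simpa [rregs] using h) _ _
  | store | set | rstore => intros; rfl
  | seq p q ihp ihq =>
    intro s h
    simp only [rregs, List.mem_append, not_or] at h
    exact (ihq h.2).trans (ihp h.1)
  | when c p ih =>
    intro s h
    simp only [den]
    split_ifs
    · exact ih h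
    · rfl
  | forN y p ih | forM y p ih =>
    intro s h
    refine iter_induction (fun _ s' => s'.rreg x = s.rreg x) rfl fun i s' _ h' => ?_
    rw [ih h, State.setReg, h']

theorem Cmd.den_rmem (c : Cmd) {a : ℕ} : ∀ {s : State}, a ∉ c.rarrays →
    (c.den n m s).rmem a = s.rmem a := by
  induction c with
  | rstore b i e => intro s h; exact Function.update_of_ne (by simpa [rarrays] using h) _ _
  | set | rset | store => intros; rfl
  | seq p q ihp ihq =>
    intro s h
    simp only [rarrays, List.mem_append, not_or] at h
    exact (ihq h.2).trans (ihp h.1)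
  | when c p ih =>
    intro s h
    simp only [den]
    split_ifs
    · exact ih h
    · rfl
  | forN y p ih | forM y p ih =>
    intro s h
    refine iter_induction (fun _ s' => s'.rmem a = s.rmem a) rfl fun i s' _ h' => ?_
    rw [ih h, State.setReg, h']

end Frame

theorem mul_add_inj {k a b i j : ℕ} (hi : i < k) (hj : j < k) :
    a * k + i = b * k + j ↔ a = b ∧ i = j := by
  refine ⟨fun h => ?_, fun ⟨h, h'⟩ => by rw [h, h']⟩
  have h1 : (a * k + i) / k = a := by
    rw [mul_comm, Nat.mul_add_div (by omega), Nat.div_eq_of_lt hi, add_zero]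
  have h2 : (b * k + j) / k = b := by
    rw [mul_comm, Nat.mul_add_div (by omega), Nat.div_eq_of_lt hj, add_zero]
  have : a = b := by rw [← h1, h, h2]
  subst this
  exact ⟨rfl, by omega⟩

/-! ### The program

Integer arrays: `0` incidence matrix, `1` indicator of `S`, `2` bought hyperedges, `3`
representatives, `5` known distances, `6` paths.  Real arrays: `0` weights, `1` residual weights,
`2` distances.  Integer registers: `2`, `3` hyperedges `e`, `f`; `4`, `5` nodes `u`, `v`; `6`
hyperedge `g`; `7` node `v₀`; `8` size of the current star; `9` whether a star has been found;
`10`, `11`, `12` hyperedge, node and size of the best star; `13` number of representatives;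
`1`, `14` loop counters.  Real registers: `1`, `2` cost of the current and of the best star;
`3`, `4` the two products to be compared. -/

/-- Index of an `m × n` array. -/
abbrev ix2 (e v : ℕ) : IExp := .add (.mulN (.var e)) (.var v)

/-- Index of an `m × n × m` array. -/
abbrev ix3 (e v g : ℕ) : IExp := .add (.mulM (ix2 e v)) (.var g)

abbrev flag (a : ℕ) (i : IExp) : Cond := .eq (.load a i) (.num 1)

open Cmd

def initCmd : Cmd := forN 5 (store 3 (.var 5) (.load 1 (.var 5)))

def clearNodes : Cmd :=
  forN 5 (seq (seq (store 5 (ix2 2 5) (.load 0 (ix2 2 5))) (rstore 2 (ix2 2 5) .zero))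
    (forM 6 (store 6 (ix3 2 5 6) (.num 0))))

/-- Compute the residual weights; record the paths from the nodes of each hyperedge. -/
def tableInit : Cmd :=
  forM 2 (seq
    (seq (rstore 1 (.var 2) (.load 0 (.var 2))) (when (flag 2 (.var 2)) (rstore 1 (.var 2) .zero)))
    clearNodes)

/-- Try to improve the path from `v` to `e` by going through `f`. -/
def relaxCmd : Cmd :=
  when (.and (flag 5 (ix2 3 5)) (.or (.not (flag 5 (ix2 2 5)))
      (.rle (.add (.load 2 (ix2 3 5)) (.load 1 (.var 3))) (.load 2 (ix2 2 5)))))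
    (seq (seq (rstore 2 (ix2 2 5) (.add (.load 2 (ix2 3 5)) (.load 1 (.var 3))))
        (store 5 (ix2 2 5) (.num 1)))
      (seq (forM 6 (store 6 (ix3 2 5 6) (.load 6 (ix3 3 5 6)))) (store 6 (ix3 2 5 3) (.num 1))))

def relaxEdge : Cmd :=
  forN 4 (when (.and (flag 0 (ix2 2 4)) (flag 0 (ix2 3 4))) (forN 5 relaxCmd))

def relaxRound : Cmd := forM 2 (forM 3 relaxEdge)

def fillTable : Cmd := seq tableInit (forM 14 relaxRound)

def inBall (e v₀ v : ℕ) : Cond :=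
  .and (flag 3 (.var v)) (.and (flag 5 (ix2 e v)) (.rle (.load 2 (ix2 e v)) (.load 2 (ix2 e v₀))))

def countReps : Cmd := seq (set 13 (.num 0)) (forN 5 (when (flag 3 (.var 5))
  (set 13 (.add (.var 13) (.num 1)))))

def evalStar : Cmd :=
  seq (seq (set 8 (.num 0)) (rset 1 (.load 1 (.var 2))))
    (forN 5 (when (inBall 2 7 5)
      (seq (set 8 (.add (.var 8) (.num 1))) (rset 1 (.add (.var 1) (.load 2 (ix2 2 5)))))))

/-- Real register `x` receives the product of real register `y` and integer register `k`. -/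
def timesCmd (x y k : ℕ) : Cmd :=
  seq (rset x .zero) (forN 4 (when (.le (.add (.var 4) (.num 1)) (.var k))
    (rset x (.add (.var x) (.var y)))))

/-- Since there is no division, densities are compared by cross-multiplying each cost with the size
of the other star. Register `12` may be stale when register `9` is not `1`; the comparison is then
irrelevant. -/
def keepBest : Cmd :=
  seq (seq (timesCmd 3 1 12) (timesCmd 4 2 8))
    (when (.or (.not (.eq (.var 9) (.num 1))) (.rle (.var 3) (.var 4)))
      (seq (seq (set 9 (.num 1)) (set 10 (.var 2)))
        (seq (set 11 (.var 7)) (seq (set 12 (.var 8)) (rset 2 (.var 1))))))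

def tryStar : Cmd :=
  when (.and (flag 3 (.var 7)) (flag 5 (ix2 2 7)))
    (seq evalStar (when (.or (.le (.num 2) (.var 8)) (.le (.var 13) (.num 1))) keepBest))

def search : Cmd := seq (seq countReps (set 9 (.num 0))) (forM 2 (forN 7 tryStar))

def addPath : Cmd := forM 6 (when (flag 6 (ix3 10 5 6)) (store 2 (.var 6) (.num 1)))

/-- Feet may be removed during the scan: membership of a later node depends only on its own flag and
on distances, which stay fixed. -/
def buyPaths : Cmd := forN 5 (when (inBall 10 11 5) (seq addPath (store 3 (.var 5) (.num 0))))

def buyCmd : Cmd :=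
  when (.eq (.var 9) (.num 1))
    (seq buyPaths (seq (store 2 (.var 10) (.num 1))
      (when (.le (.num 2) (.var 13)) (store 3 (.var 11) (.num 1)))))

def greedyStep : Cmd := seq fillTable (seq search buyCmd)

def greedyCmd : Cmd := seq initCmd (forN 1 greedyStep)

def sumCost : Cmd := seq (rset 0 .zero) (forM 6 (when (flag 2 (.var 6))
  (rset 0 (.add (.var 0) (.load 0 (.var 6))))))

def answer : Cmd := seq (seq countReps (set 0 (.num 0)))
  (when (.le (.var 13) (.num 0)) (set 0 (.num 1)))

def steinerCmd : Cmd := seq greedyCmd (seq answer sumCost)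

end RAM

/-! ### Relaxation steps on abstract tables -/

namespace WHypergraph

open Finset

open scoped Classical

variable {n m : ℕ}

/-- Improve the entry of the table for `e` and `v` by the path through `f`, if possible. -/
noncomputable def Table.relax (A : Table n m) (w : Fin m → ℝ) (e f : Fin m) (v : Fin n) :
    Table n m :=
  if A.known f v ∧ (¬ A.known e v ∨ A.dist f v + w f ≤ A.dist e v) then
    { known e' v' := (e' = e ∧ v' = v) ∨ A.known e' v'
      dist e' v' := if e' = e ∧ v' = v then A.dist f v + w f else A.dist e' v'
      path e' v' := if e' = e ∧ v' = v then insert f (A.path f v) else A.path e' v' }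
  else A

/-- The table `B` is at least as good as `A`. -/
def Table.Better (A B : Table n m) : Prop :=
  ∀ e v, A.known e v → B.known e v ∧ B.dist e v ≤ A.dist e v

/-- All known paths are correct. -/
structure Table.Sound (A : Table n m) (G : WHypergraph n m) (w : Fin m → ℝ) : Prop where
  joins : ∀ e v, A.known e v → G.Joins e v (insert e (A.path e v))
  sum_le : ∀ e v, A.known e v → ∑ f ∈ A.path e v, w f ≤ A.dist e v

/-- The table `B` takes into account the path of `A` through `f` from `v` to `e`. -/
def Table.Relaxed (A : Table n m) (w : Fin m → ℝ) (e f : Fin m) (v : Fin n) (B : Table n m) :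
    Prop :=
  A.known f v → B.known e v ∧ B.dist e v ≤ A.dist f v + w f

variable {G : WHypergraph n m} {A B C : Table n m} {w : Fin m → ℝ} {e f : Fin m} {v : Fin n}

theorem Table.Better.refl (A : Table n m) : A.Better A := fun _ _ h => ⟨h, le_rfl⟩

theorem Table.Better.trans (h : A.Better B) (h' : B.Better C) : A.Better C := fun e v hk =>
  have h1 := h e v hk
  have h2 := h' e v h1.1
  ⟨h2.1, h2.2.trans h1.2⟩

theorem Table.Relaxed.mono_right (h : A.Relaxed w e f v B) (h' : B.Better C) :
    A.Relaxed w e f v C := fun hk =>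
  have h1 := h hk
  have h2 := h' e v h1.1
  ⟨h2.1, h2.2.trans h1.2⟩

/-- Rounds update the table in place, so a relaxation may read entries better than those at the
start of the round; this shows that nothing is lost. -/
theorem Table.Relaxed.mono_left (h : B.Relaxed w e f v C) (h' : A.Better B) :
    A.Relaxed w e f v C := fun hk =>
  have h1 := h' f v hk
  have h2 := h h1.1
  ⟨h2.1, h2.2.trans (add_le_add_left h1.2 _)⟩

theorem Table.better_relax : A.Better (A.relax w e f v) := by
  intro e' v' hk
  unfold relax
  split_ifs with h
  · refine ⟨.inr hk, ?_⟩
    dsimp only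
    split_ifs with h'
    · obtain ⟨rfl, rfl⟩ := h'
      exact h.2.resolve_left (not_not.2 hk)
    · exact le_rfl
  · exact ⟨hk, le_rfl⟩

theorem Table.relaxed_relax : A.Relaxed w e f v (A.relax w e f v) := by
  intro hk
  unfold relax
  split_ifs with h
  · exact ⟨.inl ⟨rfl, rfl⟩, by simp⟩
  · push Not at h
    exact ⟨(h hk).1, (h hk).2.le⟩

/-- The common node `u` attaches `e` to the copied path. As `f` may already lie on that path, the
recorded distance is only an upper bound for the weight of the path. -/
theorem Table.Sound.relax (hA : A.Sound G w) (hw : ∀ e, 0 ≤ w e) {u : Fin n}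
    (he : u ∈ G.edge e) (hf : u ∈ G.edge f) : (A.relax w e f v).Sound G w := by
  unfold Table.relax
  split_ifs with h
  · constructor
    · intro e' v' hk
      dsimp only
      split_ifs with h'
      · obtain ⟨rfl, rfl⟩ := h'
        exact (hA.joins f v' h.1).step hf he
      · exact hA.joins e' v' (hk.resolve_left h')
    · intro e' v' hk
      dsimp only
      split_ifs with h'
      · have h1 := hA.sum_le f v h.1
        have h2 : ∑ g ∈ insert f (A.path f v), w g ≤ w f + ∑ g ∈ A.path f v, w g := by
          by_cases h3 : f ∈ A.path f v
          · rw [insert_eq_of_mem h3]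
            linarith [hw f]
          · rw [sum_insert h3]
        linarith
      · exact hA.sum_le e' v' (hk.resolve_left h')
  · exact hA

end WHypergraph

/-! ### The relaxation code and its shortest paths -/

namespace RAM

open Finset WHypergraph Cmd

open scoped Classical

variable {n m : ℕ}

/-- The table of distances held by a configuration. -/
noncomputable def State.table (n m : ℕ) (s : State) : Table n m where
  known e v := s.mem 5 (e * n + v) = 1
  dist e v := s.rmem 2 (e * n + v)
  path e v := univ.filter fun g : Fin m => s.mem 6 ((e * n + v) * m + g) = 1

/-- The residual weights held by a configuration. -/
def State.wt (m : ℕ) (s : State) (e : Fin m) : ℝ := s.rmem 1 e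

/-- After `i` passes exactly the first `i` entries of the target row have been replaced. This also
covers `e = f`, where the row is copied onto itself. -/
theorem copyPath_spec {s : State} {e f : Fin m} {v : Fin n} (h2 : s.reg 2 = e)
    (h3 : s.reg 3 = f) (h5 : s.reg 5 = v) (e' : Fin m) (v' : Fin n) (g' : Fin m) :
    ((forM 6 (store 6 (ix3 2 5 6) (.load 6 (ix3 3 5 6)))).den n m s).mem 6
        (((e' : ℕ) * n + v') * m + g') =
      if e' = e ∧ v' = v then s.mem 6 (((f : ℕ) * n + v) * m + g')
      else s.mem 6 (((e' : ℕ) * n + v') * m + g') := by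
  have key := iter_induction (b := m) (x := 6) (s := s)
    (f := (store 6 (ix3 2 5 6) (.load 6 (ix3 3 5 6))).den n m)
    (fun i s' => s'.reg 2 = e ∧ s'.reg 3 = f ∧ s'.reg 5 = v ∧
      ∀ (e' : Fin m) (v' : Fin n) (g' : Fin m), s'.mem 6 (((e' : ℕ) * n + v') * m + g') =
        if (e' = e ∧ v' = v) ∧ (g' : ℕ) < i then s.mem 6 (((f : ℕ) * n + v) * m + g')
        else s.mem 6 (((e' : ℕ) * n + v') * m + g'))
    ⟨h2, h3, h5, by simp⟩ ?_
  · refine (key.2.2.2 e' v' g').trans ?_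
    simp
  · rintro i s' hi ⟨k2, k3, k5, k⟩
    refine ⟨by simp [den, State.setReg, k2], by simp [den, State.setReg, k3],
      by simp [den, State.setReg, k5], fun e' v' g' => ?_⟩
    have hk := k f v ⟨i, hi⟩
    simp [den, State.setReg, IExp.eval, Function.update_apply,
      k2, k3, k5, mul_add_inj g'.2 hi, mul_add_inj v'.2 v.2, ← Fin.ext_iff] at hk ⊢
    rw [hk, k]
    grind

theorem relaxCmd_spec {s : State} {e f : Fin m} {v : Fin n} (h2 : s.reg 2 = e)
    (h3 : s.reg 3 = f) (h5 : s.reg 5 = v) :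
    (relaxCmd.den n m s).table n m = (s.table n m).relax (s.wt m) e f v := by
  unfold relaxCmd Table.relax
  rw [den]
  refine (apply_ite (State.table n m) _ _ _).trans (ite_congr ?_ (fun _ => ?_) fun _ => rfl)
  · simp [Cond.Holds, IExp.eval, RExp.eval, State.table, State.wt, h2, h3, h5]
  · change ((store 6 (ix3 2 5 3) (.num 1)).den n m
      ((forM 6 (store 6 (ix3 2 5 6) (.load 6 (ix3 3 5 6)))).den n m
        ((store 5 (ix2 2 5) (.num 1)).den n m ((rstore 2 (ix2 2 5)
          (.add (.load 2 (ix2 3 5)) (.load 1 (.var 3)))).den n m s)))).table n m = _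
    set s₁ := (store 5 (ix2 2 5) (.num 1)).den n m
      ((rstore 2 (ix2 2 5) (.add (.load 2 (ix2 3 5)) (.load 1 (.var 3)))).den n m s) with hs₁
    have k2 : s₁.reg 2 = e := h2
    have k3 : s₁.reg 3 = f := h3
    have k5 : s₁.reg 5 = v := h5
    have hm6 : s₁.mem 6 = s.mem 6 := rfl
    have hm5 : s₁.mem 5 = Function.update (s.mem 5) ((e : ℕ) * n + v) 1 := by
      simp [hs₁, den, IExp.eval, h2, h5]
    have hr2 : s₁.rmem 2 = Function.update (s.rmem 2) ((e : ℕ) * n + v)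
        (s.rmem 2 ((f : ℕ) * n + v) + s.rmem 1 f) := by
      simp [hs₁, den, IExp.eval, RExp.eval, h2, h3, h5]
    have hp := copyPath_spec k2 k3 k5
    set p := forM 6 (store 6 (ix3 2 5 6) (.load 6 (ix3 3 5 6))) with hpd
    have l2 : (p.den n m s₁).reg 2 = e := (p.den_reg (by decide)).trans k2
    have l3 : (p.den n m s₁).reg 3 = f := (p.den_reg (by decide)).trans k3
    have l5 : (p.den n m s₁).reg 5 = v := (p.den_reg (by decide)).trans k5
    have lm5 : (p.den n m s₁).mem 5 = s₁.mem 5 := p.den_mem (by decide)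
    have lr2 : (p.den n m s₁).rmem 2 = s₁.rmem 2 := p.den_rmem (by decide)
    -- The intermediate configurations are made opaque, so that only the recorded facts about them
    -- are used.
    clear_value s₁
    generalize p.den n m s₁ = s₂ at hp l2 l3 l5 lm5 lr2 ⊢
    clear hs₁
    ext e' v' g
    · simp [den, IExp.eval, State.table, lm5, hm5, Function.update_apply,
        mul_add_inj v'.2 v.2, ← Fin.ext_iff]
      grind
    · simp [den, IExp.eval, State.table, lr2, hr2, Function.update_apply,
        mul_add_inj v'.2 v.2, ← Fin.ext_iff, State.wt]
    · simp [den, IExp.eval, State.table, hp, hm6, Function.update_apply, l2, l3, l5,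
        mul_add_inj v'.2 v.2, mul_add_inj g.2 f.2, ← Fin.ext_iff]
      grind

/-- The command has changed nothing but the table, which has been improved, and integer registers
from `k` on. -/
structure Improves (G : WHypergraph n m) (k : ℕ) (s s' : State) : Prop where
  reg : ∀ x < k, s'.reg x = s.reg x
  inc : s'.mem 0 = s.mem 0
  wt : s'.wt m = s.wt m
  better : (s.table n m).Better (s'.table n m)
  sound : (s.table n m).Sound G (s.wt m) → (s'.table n m).Sound G (s'.wt m)

theorem Improves.refl (G : WHypergraph n m) (k : ℕ) (s : State) : Improves G k s s :=
  ⟨fun _ _ => rfl, rfl, rfl, .refl _, id⟩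

theorem Improves.trans {G : WHypergraph n m} {k : ℕ} {s₁ s₂ s₃ : State}
    (h : Improves G k s₁ s₂) (h' : Improves G k s₂ s₃) : Improves G k s₁ s₃ :=
  ⟨fun x hx => (h'.reg x hx).trans (h.reg x hx), h'.inc.trans h.inc, h'.wt.trans h.wt,
    h.better.trans h'.better, fun hs => h'.sound (h.sound hs)⟩

theorem Improves.of_setReg {G : WHypergraph n m} {k x i : ℕ} {s s' : State}
    (h : Improves G (x + 1) (s.setReg x i) s') (hk : k ≤ x) : Improves G k s s' :=
  ⟨fun y hy => (h.reg y (by omega)).trans (State.setReg_reg_of_ne _ _ (by omega)), h.inc, h.wt,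
    h.better, h.sound⟩

/-- Integer array `0` holds the incidence matrix of `G`. -/
def State.Encodes (s : State) (G : WHypergraph n m) : Prop :=
  ∀ (e : Fin m) (v : Fin n), s.mem 0 ((e : ℕ) * n + v) = 1 ↔ v ∈ G.edge e

variable {G : WHypergraph n m} {s : State}

theorem relaxNodes_spec (hw : ∀ e, 0 ≤ s.wt m e) {e f : Fin m} {u : Fin n}
    (h2 : s.reg 2 = e) (h3 : s.reg 3 = f) (he : u ∈ G.edge e) (hf : u ∈ G.edge f) :
    Improves G 5 s ((forN 5 relaxCmd).den n m s) ∧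
      ∀ v, (s.table n m).Relaxed (s.wt m) e f v
        (((forN 5 relaxCmd).den n m s).table n m) := by
  have key := iter_collect (f := relaxCmd.den n m) (x := 5) (b := n) (s := s) (Improves G 5)
    (Improves.refl G 5) (fun _ _ _ => Improves.trans)
    (fun i s' => ∀ h : i < n, (s.table n m).Relaxed (s.wt m) e f ⟨i, h⟩ (s'.table n m))
    (fun i s₁ s₂ h h' hi => (h' hi).mono_right h.better) ?_
  · exact ⟨key.1, fun v => key.2 v v.2 v.2⟩
  · intro i s' hi h
    have hspec := relaxCmd_spec (s := s'.setReg 5 i) (e := e) (f := f) (v := ⟨i, hi⟩)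
      ((h.reg 2 (by omega)).trans h2) ((h.reg 3 (by omega)).trans h3) rfl
    have hwt : (relaxCmd.den n m (s'.setReg 5 i)).wt m = s'.wt m := by
      unfold State.wt
      rw [relaxCmd.den_rmem (by decide)]
      rfl
    refine ⟨⟨fun x hx => ?_, relaxCmd.den_mem (by decide), hwt, ?_, fun hs => ?_⟩, fun _ => ?_⟩
    · exact (relaxCmd.den_reg (by simp [relaxCmd, regs]; omega)).trans
        (State.setReg_reg_of_ne _ _ (by omega))
    · rw [hspec]
      exact Table.better_relax
    · rw [hspec, hwt]
      exact hs.relax (fun e => by rw [h.wt]; exact hw e) he hf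
    · rw [hspec]
      rw [show (s'.setReg 5 i).wt m = s.wt m from h.wt]
      exact Table.relaxed_relax.mono_left h.better

theorem relaxEdge_spec (hG : s.Encodes G) (hw : ∀ e, 0 ≤ s.wt m e) {e f : Fin m}
    (h2 : s.reg 2 = e) (h3 : s.reg 3 = f) :
    Improves G 4 s (relaxEdge.den n m s) ∧
      ∀ u ∈ G.edge e, u ∈ G.edge f → ∀ v, (s.table n m).Relaxed (s.wt m) e f v
        ((relaxEdge.den n m s).table n m) := by
  have key := iter_collect (b := n) (x := 4) (s := s)
    (f := (when (.and (flag 0 (ix2 2 4)) (flag 0 (ix2 3 4))) (forN 5 relaxCmd)).den n m)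
    (Improves G 4) (Improves.refl G 4) (fun _ _ _ => Improves.trans)
    (fun i s' => ∀ h : i < n, ⟨i, h⟩ ∈ G.edge e → ⟨i, h⟩ ∈ G.edge f →
      ∀ v, (s.table n m).Relaxed (s.wt m) e f v (s'.table n m))
    (fun i s₁ s₂ h h' hi he hf v => (h' hi he hf v).mono_right h.better) ?_
  · exact ⟨key.1, fun u he hf v => key.2 u u.2 u.2 he hf v⟩
  · intro i s' hi h
    have k2 : (s'.setReg 4 i).reg 2 = e := (h.reg 2 (by omega)).trans h2
    have k3 : (s'.setReg 4 i).reg 3 = f := (h.reg 3 (by omega)).trans h3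
    have hc : (Cond.and (flag 0 (ix2 2 4)) (flag 0 (ix2 3 4))).Holds n m (s'.setReg 4 i) ↔
        (⟨i, hi⟩ ∈ G.edge e ∧ ⟨i, hi⟩ ∈ G.edge f) := by
      rw [← hG, ← hG, ← h.inc]
      simp [Cond.Holds, IExp.eval, k2, k3]
      rfl
    rw [den]
    by_cases hu : ⟨i, hi⟩ ∈ G.edge e ∧ ⟨i, hi⟩ ∈ G.edge f
    · rw [if_pos (hc.2 hu)]
      have hr := relaxNodes_spec (G := G) (s := s'.setReg 4 i)
        (fun e => (congrFun h.wt e).symm ▸ hw e) k2 k3 hu.1 hu.2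
      refine ⟨hr.1.of_setReg le_rfl, fun _ _ _ v => ?_⟩
      have h1 := hr.2 v
      rw [show (s'.setReg 4 i).wt m = s.wt m from h.wt] at h1
      exact h1.mono_left h.better
    · rw [if_neg (fun h => hu (hc.1 h))]
      exact ⟨Improves.of_setReg (Improves.refl G _ _) le_rfl, fun _ he hf => absurd ⟨he, hf⟩ hu⟩

theorem relaxRound_spec (hG : s.Encodes G) (hw : ∀ e, 0 ≤ s.wt m e) :
    Improves G 2 s (relaxRound.den n m s) ∧
      ∀ e f, ∀ u ∈ G.edge e, u ∈ G.edge f → ∀ v, (s.table n m).Relaxed (s.wt m) e f v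
        ((relaxRound.den n m s).table n m) := by
  have key := iter_collect (b := m) (x := 2) (s := s) (f := (forM 3 relaxEdge).den n m)
    (Improves G 2) (Improves.refl G 2) (fun _ _ _ => Improves.trans)
    (fun i s' => ∀ h : i < m, ∀ f, ∀ u ∈ G.edge ⟨i, h⟩, u ∈ G.edge f →
      ∀ v, (s.table n m).Relaxed (s.wt m) ⟨i, h⟩ f v (s'.table n m))
    (fun i s₁ s₂ h h' hi f u he hf v => (h' hi f u he hf v).mono_right h.better) ?_
  · exact ⟨key.1, fun e f u he hf v => key.2 e e.2 e.2 f u he hf v⟩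
  · intro i s' hi h
    have key' := iter_collect (b := m) (x := 3) (s := s'.setReg 2 i) (f := relaxEdge.den n m)
      (Improves G 3) (Improves.refl G 3) (fun _ _ _ => Improves.trans)
      (fun j s'' => ∀ h : j < m, ∀ u ∈ G.edge ⟨i, hi⟩, u ∈ G.edge ⟨j, h⟩ →
        ∀ v, (s.table n m).Relaxed (s.wt m) ⟨i, hi⟩ ⟨j, h⟩ v (s''.table n m))
      (fun j s₁ s₂ h h' hj u he hf v => (h' hj u he hf v).mono_right h.better) ?_
    · exact ⟨key'.1.of_setReg le_rfl, fun _ f u he hf v => key'.2 f f.2 f.2 u he hf v⟩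
    · intro j s'' hj h''
      have hwt : s''.wt m = s.wt m := h''.wt.trans h.wt
      have hr := relaxEdge_spec (G := G) (s := s''.setReg 3 j) (e := ⟨i, hi⟩) (f := ⟨j, hj⟩)
        (fun e v => by
          rw [show (s''.setReg 3 j).mem 0 = s.mem 0 from h''.inc.trans h.inc]; exact hG e v)
        (fun e => (congrFun hwt e).symm ▸ hw e) (h''.reg 2 (by omega)) rfl
      refine ⟨hr.1.of_setReg le_rfl, fun _ u he hf v => ?_⟩
      have h1 := hr.2 u he hf v
      rw [show (s''.setReg 3 j).wt m = s.wt m from hwt] at h1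
      exact (h1.mono_left h''.better).mono_left h.better

/-- After `i` rounds, the table accounts for all chains of at most `i` hyperedges. -/
theorem rounds_spec (hG : s.Encodes G) (hw : ∀ e, 0 ≤ s.wt m e)
    (hs : (s.table n m).Sound G (s.wt m))
    (h0 : ∀ e v, v ∈ G.edge e → (s.table n m).known e v ∧ (s.table n m).dist e v ≤ 0) :
    (((forM 14 relaxRound).den n m s).table n m).IsShortest G (s.wt m) := by
  have key := iter_induction (b := m) (x := 14) (s := s) (f := relaxRound.den n m)
    (fun i s' => Improves G 2 s s' ∧ ∀ e v Q, G.Chain v Q e → Q.card ≤ i →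
      (s'.table n m).known e v ∧ (s'.table n m).dist e v ≤ ∑ g ∈ Q, s.wt m g)
    ⟨Improves.refl G 2 s, fun e v Q hc hQ => ?_⟩ ?_
  · obtain ⟨h1, h2⟩ := key
    have := h1.sound hs
    rw [h1.wt] at this
    -- A chain uses each hyperedge at most once, so `m` rounds reach all of them.
    exact ⟨this.joins, this.sum_le, fun e v Q hc => h2 e v Q hc (by simpa using Q.card_le_univ)⟩
  · cases hc with
    | start h => simpa using h0 e v h
    | step => simp at hQ
  · rintro i s' hi ⟨h1, h2⟩
    have hr := relaxRound_spec (G := G) (s := s'.setReg 14 i)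
      (fun e v => by rw [show (s'.setReg 14 i).mem 0 = s.mem 0 from h1.inc]; exact hG e v)
      (fun e => (congrFun h1.wt e).symm ▸ hw e)
    have hr1 : Improves G 2 s' (relaxRound.den n m (s'.setReg 14 i)) :=
      ⟨fun x hx => (hr.1.reg x hx).trans (State.setReg_reg_of_ne _ _ (by omega)), hr.1.inc,
        hr.1.wt, hr.1.better, hr.1.sound⟩
    refine ⟨h1.trans hr1, fun e v Q hc hQ => ?_⟩
    cases hc with
    | start h =>
      obtain ⟨k1, k2⟩ := h2 e v ∅ (.start h) (by simp)
      obtain ⟨k3, k4⟩ := hr1.better e v k1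
      exact ⟨k3, k4.trans k2⟩
    | @step Q f _ u hc hf hu he =>
      rw [card_insert_of_notMem hf] at hQ
      obtain ⟨k1, k2⟩ := h2 f v Q hc (by omega)
      have h3 := hr.2 e f u he hu v
      rw [show (s'.setReg 14 i).wt m = s.wt m from h1.wt] at h3
      obtain ⟨k3, k4⟩ := h3 k1
      refine ⟨k3, k4.trans ?_⟩
      rw [sum_insert hf, add_comm]
      exact add_le_add_right k2 _

end RAM

namespace RAM

open Finset WHypergraph Cmd

open scoped Classical

variable {n m : ℕ} {G : WHypergraph n m} {s : State}

theorem Cmd.den_mem_eq (c : Cmd) (h : c.arrays = []) (s : State) : (c.den n m s).mem = s.mem :=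
  funext fun _ => c.den_mem (by simp [h])

theorem Cmd.den_rmem_eq (c : Cmd) (h : c.rarrays = []) (s : State) :
    (c.den n m s).rmem = s.rmem :=
  funext fun _ => c.den_rmem (by simp [h])

/-! ### Initialization of the table -/

/-- The residual weight that entry `i` of real array `1` should hold. -/
noncomputable def State.resid (s : State) (i : ℕ) : ℝ := if s.mem 2 i = 1 then 0 else s.rmem 0 i

/-- Only integer registers from `k` on and the arrays of the table and of the residual weights have
been changed, and no entry with the correct initial value has been spoiled. -/
structure Resets (k : ℕ) (s s' : State) : Prop where
  reg : ∀ x < k, s'.reg x = s.reg x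
  inc : s'.mem 0 = s.mem 0
  sol : s'.mem 2 = s.mem 2
  wt : s'.rmem 0 = s.rmem 0
  known : ∀ i, s.mem 5 i = s.mem 0 i → s'.mem 5 i = s'.mem 0 i
  dist : ∀ i, s.rmem 2 i = 0 → s'.rmem 2 i = 0
  path : ∀ i, s.mem 6 i = 0 → s'.mem 6 i = 0
  res : ∀ i, s.rmem 1 i = s.resid i → s'.rmem 1 i = s'.resid i

theorem Resets.refl (k : ℕ) (s : State) : Resets k s s :=
  ⟨fun _ _ => rfl, rfl, rfl, rfl, fun _ h => h, fun _ h => h, fun _ h => h, fun _ h => h⟩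

theorem Resets.trans {k : ℕ} {s₁ s₂ s₃ : State} (h : Resets k s₁ s₂) (h' : Resets k s₂ s₃) :
    Resets k s₁ s₃ :=
  ⟨fun x hx => (h'.reg x hx).trans (h.reg x hx), h'.inc.trans h.inc, h'.sol.trans h.sol,
    h'.wt.trans h.wt, fun i hi => h'.known i (h.known i hi), fun i hi => h'.dist i (h.dist i hi),
    fun i hi => h'.path i (h.path i hi), fun i hi => h'.res i (h.res i hi)⟩

theorem Resets.mono {k k' : ℕ} {s s' : State} (h : Resets k s s') (hk : k' ≤ k) :
    Resets k' s s' := { h with reg := fun x hx => h.reg x (hx.trans_le hk) }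

theorem Resets.of_setReg {k x i : ℕ} {s s' : State} (h : Resets (x + 1) (s.setReg x i) s')
    (hk : k ≤ x) : Resets k s s' :=
  ⟨fun y hy => (h.reg y (by omega)).trans (State.setReg_reg_of_ne _ _ (by omega)), h.inc, h.sol,
    h.wt, h.known, h.dist, h.path, h.res⟩

theorem clearPath_spec {e v : ℕ} (h2 : s.reg 2 = e) (h5 : s.reg 5 = v) :
    Resets 6 s ((forM 6 (store 6 (ix3 2 5 6) (.num 0))).den n m s) ∧
      ∀ i < m, ((forM 6 (store 6 (ix3 2 5 6) (.num 0))).den n m s).mem 6 ((e * n + v) * m + i) =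
        0 := by
  refine iter_collect (b := m) (x := 6) (s := s)
    (f := (store 6 (ix3 2 5 6) (.num 0)).den n m) (Resets 6) (Resets.refl 6)
    (fun _ _ _ => Resets.trans) (fun i s' => s'.mem 6 ((e * n + v) * m + i) = 0)
    (fun i s₁ s₂ h => h.path _) fun i s' _ h => ⟨?_, ?_⟩
  · refine Resets.of_setReg ⟨fun _ _ => rfl, rfl, rfl, rfl, fun _ h => h, fun _ h => h,
      fun j hj => ?_, fun _ h => h⟩ le_rfl
    simp only [den, Function.update_self, Function.update_apply, IExp.eval]
    split_ifs
    · rfl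
    · exact hj
  · have k2 : (s'.setReg 6 i).reg 2 = e := (h.reg 2 (by omega)).trans h2
    have k5 : (s'.setReg 6 i).reg 5 = v := (h.reg 5 (by omega)).trans h5
    simp [den, IExp.eval, k2, k5]

theorem clearNodes_spec {e : ℕ} (h2 : s.reg 2 = e) :
    Resets 5 s (clearNodes.den n m s) ∧ ∀ v < n,
      (clearNodes.den n m s).mem 5 (e * n + v) = (clearNodes.den n m s).mem 0 (e * n + v) ∧
      (clearNodes.den n m s).rmem 2 (e * n + v) = 0 ∧
      ∀ i < m, (clearNodes.den n m s).mem 6 ((e * n + v) * m + i) = 0 := by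
  refine iter_collect (b := n) (x := 5) (s := s) (Resets 5) (Resets.refl 5)
    (fun _ _ _ => Resets.trans) (fun v s' => s'.mem 5 (e * n + v) = s'.mem 0 (e * n + v) ∧
      s'.rmem 2 (e * n + v) = 0 ∧ ∀ i < m, s'.mem 6 ((e * n + v) * m + i) = 0)
    (fun v s₁ s₂ h h' => ⟨h.known _ h'.1, h.dist _ h'.2.1, fun i hi => h.path _ (h'.2.2 i hi)⟩)
    fun v s' hv h => ?_
  have k2 : (s'.setReg 5 v).reg 2 = e := (h.reg 2 (by omega)).trans h2
  obtain ⟨s₁, hs₁⟩ : ∃ s₁, s₁ = (seq (store 5 (ix2 2 5) (.load 0 (ix2 2 5)))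
    (rstore 2 (ix2 2 5) .zero)).den n m (s'.setReg 5 v) := ⟨_, rfl⟩
  rw [den, ← hs₁]
  have h1 : Resets 6 (s'.setReg 5 v) s₁ := by
    subst hs₁
    refine ⟨fun _ _ => rfl, rfl, rfl, rfl, fun i hi => ?_, fun i hi => ?_, fun _ h => h,
      fun _ h => h⟩
    · simp only [den, Function.update_self, Function.update_apply, IExp.eval, OfNat.zero_ne_ofNat,
        if_false]
      split_ifs with h
      · rw [h]
      · exact hi
    · simp only [den, Function.update_self, Function.update_apply, IExp.eval, RExp.eval]
      split_ifs
      · rfl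
      · exact hi
  have l2 : s₁.reg 2 = e := (h1.reg 2 (by omega)).trans k2
  have l5 : s₁.reg 5 = v := h1.reg 5 (by omega)
  have hc := clearPath_spec (n := n) (m := m) l2 l5
  refine ⟨(h1.trans hc.1).of_setReg le_rfl, hc.1.known _ ?_, hc.1.dist _ ?_, hc.2⟩
  · simp [hs₁, den, IExp.eval, k2]
  · simp [hs₁, den, IExp.eval, RExp.eval, k2]

/-- The starting configuration is arbitrary, since the arrays still hold the previous round. Every
write stores a correct initial value, so correctness of an entry persists and no disjointness of
addresses is needed. -/
theorem tableInit_spec : Resets 2 s (tableInit.den n m s) ∧ ∀ e < m,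
    (tableInit.den n m s).rmem 1 e = (tableInit.den n m s).resid e ∧ ∀ v < n,
      (tableInit.den n m s).mem 5 (e * n + v) = (tableInit.den n m s).mem 0 (e * n + v) ∧
      (tableInit.den n m s).rmem 2 (e * n + v) = 0 ∧
      ∀ i < m, (tableInit.den n m s).mem 6 ((e * n + v) * m + i) = 0 := by
  refine iter_collect (b := m) (x := 2) (s := s) (Resets 2) (Resets.refl 2)
    (fun _ _ _ => Resets.trans) (fun e s' => s'.rmem 1 e = s'.resid e ∧
      ∀ v < n, s'.mem 5 (e * n + v) = s'.mem 0 (e * n + v) ∧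
      s'.rmem 2 (e * n + v) = 0 ∧ ∀ i < m, s'.mem 6 ((e * n + v) * m + i) = 0)
    (fun v s₁ s₂ h h' => ⟨h.res _ h'.1, fun v hv => ⟨h.known _ (h'.2 v hv).1,
      h.dist _ (h'.2 v hv).2.1, fun i hi => h.path _ ((h'.2 v hv).2.2 i hi)⟩⟩)
    fun e s' he h => ?_
  obtain ⟨s₁, hs₁⟩ : ∃ s₁, s₁ = (seq (rstore 1 (.var 2) (.load 0 (.var 2)))
    (when (flag 2 (.var 2)) (rstore 1 (.var 2) .zero))).den n m (s'.setReg 2 e) := ⟨_, rfl⟩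
  rw [den, ← hs₁]
  have hmem : s₁.mem = s'.mem := by rw [hs₁]; exact Cmd.den_mem_eq _ rfl _
  have hreg : s₁.reg = (s'.setReg 2 e).reg := by
    rw [hs₁]; exact funext fun _ => Cmd.den_reg _ (by simp [regs])
  have hr0 : s₁.rmem 0 = s'.rmem 0 := by rw [hs₁]; exact Cmd.den_rmem _ (by decide)
  have hr2 : s₁.rmem 2 = s'.rmem 2 := by rw [hs₁]; exact Cmd.den_rmem _ (by decide)
  have hr1 : s₁.rmem 1 = Function.update (s'.rmem 1) e (s'.resid e) := by
    simp only [hs₁, den, Cond.Holds, IExp.eval, RExp.eval, State.setReg, Function.update_self,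
      State.resid]
    split_ifs <;> simp
  have hrs : s₁.resid = s'.resid := by
    funext i
    simp only [State.resid, hmem, hr0]
  have h1 : Resets 3 (s'.setReg 2 e) s₁ := by
    refine ⟨fun _ _ => by rw [hreg], by rw [hmem]; rfl, by rw [hmem]; rfl, hr0,
      fun _ h => by rw [hmem]; exact h, fun _ h => by rw [hr2]; exact h,
      fun _ h => by rw [hmem]; exact h, fun i hi => ?_⟩
    rw [hr1, hrs, Function.update_apply]
    split_ifs with h
    · rw [h]
    · exact hi
  have hc := clearNodes_spec (n := n) (m := m) (s := s₁) (e := e) (by rw [hreg]; rfl)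
  refine ⟨(h1.trans (hc.1.mono (by omega))).of_setReg le_rfl, hc.1.res _ ?_, hc.2⟩
  rw [hr1, hrs, Function.update_self]

/-! ### Search for the best star -/

/-- The representatives held by a configuration. -/
def State.reps (n : ℕ) (s : State) : Finset (Fin n) := univ.filter fun v => s.mem 3 v = 1

theorem countReps_spec : (countReps.den n m s).reg 13 = (s.reps n).card := by
  have key := iter_induction (b := n) (x := 5) (s := s.setReg 13 0)
    (f := (when (flag 3 (.var 5)) (set 13 (.add (.var 13) (.num 1)))).den n m)
    (fun i s' => s'.mem = s.mem ∧ s'.reg 13 = ∑ j ∈ range i, if s.mem 3 j = 1 then 1 else 0)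
    ⟨rfl, by simp⟩ ?_
  · refine key.2.trans ?_
    rw [sum_range, State.reps, card_filter]
  · rintro i s' _ ⟨h1, h2⟩
    refine ⟨(Cmd.den_mem_eq _ rfl _).trans h1, ?_⟩
    simp only [den, Cond.Holds, IExp.eval, State.setReg, Function.update_self, h1]
    rw [sum_range_succ, ← h2]
    split_ifs <;> simp

theorem evalStar_spec {e : Fin m} {v₀ : Fin n} (h2 : s.reg 2 = e) (h7 : s.reg 7 = v₀) :
    (evalStar.den n m s).reg 8 = ((s.table n m).ball (s.reps n) e v₀).card ∧
    (evalStar.den n m s).rreg 1 = (s.table n m).starCost (s.wt m) (s.reps n) e v₀ := by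
  have key := iter_induction (b := n) (x := 5)
    (s := (rset 1 (.load 1 (.var 2))).den n m (s.setReg 8 0))
    (f := (when (inBall 2 7 5)
      (seq (set 8 (.add (.var 8) (.num 1))) (rset 1 (.add (.var 1) (.load 2 (ix2 2 5)))))).den n m)
    (fun i s' => s'.mem = s.mem ∧ s'.rmem = s.rmem ∧ s'.reg 2 = e ∧ s'.reg 7 = v₀ ∧
      s'.reg 8 = (∑ j ∈ range i, if s.mem 3 j = 1 ∧ s.mem 5 (e * n + j) = 1 ∧
        s.rmem 2 (e * n + j) ≤ s.rmem 2 (e * n + v₀) then 1 else 0) ∧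
      s'.rreg 1 = s.rmem 1 e + ∑ j ∈ range i, if s.mem 3 j = 1 ∧ s.mem 5 (e * n + j) = 1 ∧
        s.rmem 2 (e * n + j) ≤ s.rmem 2 (e * n + v₀) then s.rmem 2 (e * n + j) else 0)
    ⟨rfl, rfl, h2, h7, by simp [den, State.setReg],
      by simp [den, State.setReg, RExp.eval, IExp.eval, h2]⟩ ?_
  · obtain ⟨-, -, -, -, k8, k1⟩ := key
    have hball : (s.table n m).ball (s.reps n) e v₀ = univ.filter fun v : Fin n =>
        s.mem 3 v = 1 ∧ s.mem 5 (e * n + v) = 1 ∧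
          s.rmem 2 (e * n + v) ≤ s.rmem 2 (e * n + v₀) := by
      ext v
      simp [Table.mem_ball, State.reps, State.table]
    constructor
    · refine k8.trans ?_
      rw [sum_range, hball, card_filter]
    · refine k1.trans ?_
      rw [sum_range, Table.starCost, hball, sum_filter]
      rfl
  · rintro i s' _ ⟨k1, k2, k3, k4, k5, k6⟩
    refine ⟨(Cmd.den_mem_eq _ rfl _).trans k1, (Cmd.den_rmem_eq _ rfl _).trans k2,
      (Cmd.den_reg _ (by decide)).trans k3, (Cmd.den_reg _ (by decide)).trans k4, ?_⟩
    rw [sum_range_succ, sum_range_succ, ← add_assoc, ← k5, ← k6]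
    have hc : (inBall 2 7 5).Holds n m (s'.setReg 5 i) ↔ (s.mem 3 i = 1 ∧
        s.mem 5 (e * n + i) = 1 ∧ s.rmem 2 (e * n + i) ≤ s.rmem 2 (e * n + v₀)) := by
      simp [inBall, Cond.Holds, IExp.eval, RExp.eval, State.setReg, k1, k2, k3, k4]
    rw [den]
    by_cases h : s.mem 3 i = 1 ∧ s.mem 5 (e * n + i) = 1 ∧
        s.rmem 2 (e * n + i) ≤ s.rmem 2 (e * n + v₀)
    · rw [if_pos (hc.2 h), if_pos h, if_pos h]
      simp [den, IExp.eval, RExp.eval, State.setReg, k2, k3]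
    · rw [if_neg (fun h' => h (hc.1 h')), if_neg h, if_neg h]
      exact ⟨rfl, (add_zero _).symm⟩

/-- The loop makes `n` passes and adds only in the first `reg k` of them, hence the bound on `reg
k`. -/
theorem timesCmd_spec {x y k : ℕ} (hxy : x ≠ y) (hk : k ≠ 4) (hn : s.reg k ≤ n) :
    ((timesCmd x y k).den n m s).rreg x = s.rreg y * s.reg k := by
  have key := iter_induction (b := n) (x := 4) (s := (rset x .zero).den n m s)
    (f := (when (.le (.add (.var 4) (.num 1)) (.var k)) (rset x (.add (.var x) (.var y)))).den n m)
    (fun i s' => s'.reg k = s.reg k ∧ s'.rreg y = s.rreg y ∧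
      s'.rreg x = s.rreg y * (min i (s.reg k) : ℕ))
    ⟨rfl, Function.update_of_ne hxy.symm _ _, by simp [den, RExp.eval]⟩ ?_
  · refine key.2.2.trans ?_
    rw [min_eq_right hn]
  · rintro i s' _ ⟨k1, k2, k3⟩
    refine ⟨(Cmd.den_reg _ (by simp [regs])).trans ((State.setReg_reg_of_ne _ _ hk).trans k1),
      (Cmd.den_rreg _ (by simp [rregs, hxy.symm])).trans k2, ?_⟩
    simp only [den, Cond.Holds, IExp.eval, RExp.eval, State.setReg, Function.update_self, k1,
      Function.update_of_ne hk]
    split_ifs with h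
    · refine (Function.update_self ..).trans ?_
      rw [k2, k3, min_eq_left (by omega), min_eq_left (by omega)]
      push_cast
      ring
    · rw [k3, min_eq_right (by omega), min_eq_right (by omega)]

/-- The registers hold the best star among those in `D`. -/
def Best (A : Table n m) (w : Fin m → ℝ) (R : Finset (Fin n)) (D : Fin m → Fin n → Prop)
    (s : State) : Prop :=
  (s.reg 9 ≠ 1 ∧ ∀ e v, D e v → ¬ A.IsStar R e v) ∨
  (s.reg 9 = 1 ∧ ∃ (e : Fin m) (v : Fin n), s.reg 10 = e ∧ s.reg 11 = v ∧ A.IsStar R e v ∧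
    s.rreg 2 = A.starCost w R e v ∧ s.reg 12 = (A.ball R e v).card ∧
    ∀ e' v', D e' v' → A.IsStar R e' v' →
      A.starCost w R e v / (A.ball R e v).card ≤ A.starCost w R e' v' / (A.ball R e' v').card)

theorem Best.congr {A : Table n m} {w : Fin m → ℝ} {R : Finset (Fin n)}
    {D D' : Fin m → Fin n → Prop} {s s' : State} (h : Best A w R D s)
    (h9 : s'.reg 9 = s.reg 9) (h10 : s'.reg 10 = s.reg 10) (h11 : s'.reg 11 = s.reg 11)
    (h12 : s'.reg 12 = s.reg 12) (h2 : s'.rreg 2 = s.rreg 2)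
    (hD : ∀ e v, D' e v → A.IsStar R e v → D e v) : Best A w R D' s' := by
  unfold Best at h ⊢
  rw [h9, h10, h11, h12, h2]
  rcases h with ⟨h, h'⟩ | ⟨h, e, v, h3, h4, h5, h6, h7, h8⟩
  · exact .inl ⟨h, fun e v hd hs => h' e v (hD e v hd hs) hs⟩
  · exact .inr ⟨h, e, v, h3, h4, h5, h6, h7, fun e' v' hd hs => h8 e' v' (hD e' v' hd hs) hs⟩

theorem keepBest_spec {A : Table n m} {w : Fin m → ℝ} {R : Finset (Fin n)}
    {D : Fin m → Fin n → Prop} {e : Fin m} {v₀ : Fin n} (hs : A.IsStar R e v₀)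
    (h2 : s.reg 2 = e) (h7 : s.reg 7 = v₀) (h8 : s.reg 8 = (A.ball R e v₀).card)
    (h1 : s.rreg 1 = A.starCost w R e v₀) (h : Best A w R D s) :
    Best A w R (fun e' v' => D e' v' ∨ (e' = e ∧ v' = v₀)) (keepBest.den n m s) := by
  have hcard : ∀ (e : Fin m) (v : Fin n), (A.ball R e v).card ≤ n := fun e v => by
    simpa using (A.ball R e v).card_le_univ
  have hpos : ∀ (e : Fin m) (v : Fin n), A.IsStar R e v → (0 : ℝ) < (A.ball R e v).card :=
    fun e v h => by exact_mod_cast card_pos.2 ⟨v, Table.self_mem_ball h.1 h.2.1⟩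
  obtain ⟨s₁, hs₁⟩ : ∃ s₁, s₁ = (timesCmd 3 1 12).den n m s := ⟨_, rfl⟩
  obtain ⟨s₂, hs₂⟩ : ∃ s₂, s₂ = (timesCmd 4 2 8).den n m s₁ := ⟨_, rfl⟩
  have hreg : ∀ x, x ≠ 4 → s₂.reg x = s.reg x := fun x hx => by
    rw [hs₂, Cmd.den_reg _ (by simpa [timesCmd, regs]), hs₁,
      Cmd.den_reg _ (by simpa [timesCmd, regs])]
  have hrreg : ∀ x, x ≠ 3 → x ≠ 4 → s₂.rreg x = s.rreg x := fun x hx hx' => by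
    rw [hs₂, Cmd.den_rreg _ (by simpa [timesCmd, rregs]), hs₁,
      Cmd.den_rreg _ (by simpa [timesCmd, rregs])]
  -- The bound on register `12` is a hypothesis here because it is only available once some star has
  -- been recorded.
  have hA : s.reg 12 ≤ n → s₂.rreg 3 = s.rreg 1 * s.reg 12 := fun hn => by
    rw [hs₂, Cmd.den_rreg _ (by decide), hs₁, timesCmd_spec (by omega) (by omega) hn]
  have hB : s₂.rreg 4 = s.rreg 2 * s.reg 8 := by
    have k8 : s₁.reg 8 = s.reg 8 := by rw [hs₁]; exact Cmd.den_reg _ (by decide)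
    have k2 : s₁.rreg 2 = s.rreg 2 := by rw [hs₁]; exact Cmd.den_rreg _ (by decide)
    rw [hs₂, timesCmd_spec (by omega) (by omega) (by rw [k8, h8]; exact hcard _ _), k8, k2]
  have hden : keepBest.den n m s = (when (.or (.not (.eq (.var 9) (.num 1)))
      (.rle (.var 3) (.var 4))) (seq (seq (set 9 (.num 1)) (set 10 (.var 2)))
        (seq (set 11 (.var 7)) (seq (set 12 (.var 8)) (rset 2 (.var 1)))))).den n m s₂ := by
    rw [hs₂, hs₁]; rfl
  rw [hden, den]
  have hnew : (∀ e' v', D e' v' → A.IsStar R e' v' → A.starCost w R e v₀ / (A.ball R e v₀).card ≤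
        A.starCost w R e' v' / (A.ball R e' v').card) →
      Best A w R (fun e' v' => D e' v' ∨ (e' = e ∧ v' = v₀))
        ((seq (seq (set 9 (.num 1)) (set 10 (.var 2)))
          (seq (set 11 (.var 7)) (seq (set 12 (.var 8)) (rset 2 (.var 1))))).den n m s₂) := by
    intro hmin
    refine .inr ⟨rfl, e, v₀, (hreg 2 (by omega)).trans h2, (hreg 7 (by omega)).trans h7, hs,
      (hrreg 1 (by omega) (by omega)).trans h1, (hreg 8 (by omega)).trans h8, ?_⟩
    rintro e' v' (hd | ⟨rfl, rfl⟩) hs'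
    · exact hmin e' v' hd hs'
    · exact le_rfl
  have hc : (Cond.or (.not (.eq (.var 9) (.num 1))) (.rle (.var 3) (.var 4))).Holds n m s₂ ↔
      (s.reg 9 ≠ 1 ∨ s₂.rreg 3 ≤ s₂.rreg 4) := by
    simp [Cond.Holds, IExp.eval, RExp.eval, hreg]
  rcases h with ⟨h9, hno⟩ | ⟨h9, e', v', h10, h11, hs', hr2, h12, hmin⟩
  · rw [if_pos (hc.2 (.inl h9))]
    exact hnew fun e' v' hd hs' => absurd hs' (hno e' v' hd)
  · have hiff : s₂.rreg 3 ≤ s₂.rreg 4 ↔ A.starCost w R e v₀ / (A.ball R e v₀).card ≤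
        A.starCost w R e' v' / (A.ball R e' v').card := by
      rw [hA (by rw [h12]; exact hcard _ _), hB, h1, h8, hr2, h12,
        div_le_div_iff₀ (hpos _ _ hs) (hpos _ _ hs')]
    split_ifs with h
    · have hle := hiff.1 ((hc.1 h).resolve_left (not_not.2 h9))
      exact hnew fun e'' v'' hd hs'' => hle.trans (hmin e'' v'' hd hs'')
    · refine .inr ⟨(hreg 9 (by omega)).trans h9, e', v', (hreg 10 (by omega)).trans h10,
        (hreg 11 (by omega)).trans h11, hs', (hrreg 2 (by omega) (by omega)).trans hr2,
        (hreg 12 (by omega)).trans h12, ?_⟩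
      rintro e'' v'' (hd | ⟨rfl, rfl⟩) hs''
      · exact hmin e'' v'' hd hs''
      · exact (not_le.1 fun hle => h (hc.2 (.inr (hiff.2 hle)))).le

theorem tryStar_spec {D : Fin m → Fin n → Prop} {e : Fin m} {v₀ : Fin n}
    (h2 : s.reg 2 = e) (h7 : s.reg 7 = v₀) (h13 : s.reg 13 = (s.reps n).card)
    (h : Best (s.table n m) (s.wt m) (s.reps n) D s) :
    Best (s.table n m) (s.wt m) (s.reps n) (fun e' v' => D e' v' ∨ (e' = e ∧ v' = v₀))
      (tryStar.den n m s) := by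
  have hsame : ¬ (s.table n m).IsStar (s.reps n) e v₀ →
      ∀ e' v', (D e' v' ∨ (e' = e ∧ v' = v₀)) → (s.table n m).IsStar (s.reps n) e' v' →
        D e' v' := by
    rintro hns e' v' (hd | ⟨rfl, rfl⟩) hs
    · exact hd
    · exact absurd hs hns
  have hc : (Cond.and (flag 3 (.var 7)) (flag 5 (ix2 2 7))).Holds n m s ↔
      (v₀ ∈ s.reps n ∧ (s.table n m).known e v₀) := by
    simp [Cond.Holds, IExp.eval, h2, h7, State.reps, State.table]
  rw [tryStar, den]
  split_ifs with h1
  · rw [hc] at h1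
    obtain ⟨k8, k1⟩ := evalStar_spec h2 h7
    have k2 : (evalStar.den n m s).reg 2 = e := (Cmd.den_reg _ (by decide)).trans h2
    have k7 : (evalStar.den n m s).reg 7 = v₀ := (Cmd.den_reg _ (by decide)).trans h7
    have k13 : (evalStar.den n m s).reg 13 = (s.reps n).card :=
      (Cmd.den_reg _ (by decide)).trans h13
    have hb := fun D' (hD : ∀ e v, D' e v → (s.table n m).IsStar (s.reps n) e v → D e v) =>
      Best.congr (D' := D') (s' := evalStar.den n m s) h (Cmd.den_reg _ (by decide))
        (Cmd.den_reg _ (by decide)) (Cmd.den_reg _ (by decide)) (Cmd.den_reg _ (by decide))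
        (Cmd.den_rreg _ (by decide)) hD
    rw [den, den]
    have hc' : (Cond.or (.le (.num 2) (.var 8)) (.le (.var 13) (.num 1))).Holds n m
        (evalStar.den n m s) ↔ (s.table n m).IsStar (s.reps n) e v₀ := by
      simp [Cond.Holds, IExp.eval, k8, k13, Table.IsStar, h1]
    split_ifs with h3
    · exact keepBest_spec (hc'.1 h3) k2 k7 k8 k1 (hb D fun _ _ h _ => h)
    · exact hb _ (hsame fun hs => h3 (hc'.2 hs))
  · exact h.congr rfl rfl rfl rfl rfl (hsame fun hs => h1 (hc.2 ⟨hs.1, hs.2.1⟩))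

/-- The pairs examined so far form an initial segment in lexicographic order, which is the set `D`
in the invariant of the nested loops. -/
theorem search_spec : (search.den n m s).reg 13 = (s.reps n).card ∧
    Best (s.table n m) (s.wt m) (s.reps n) (fun _ _ => True) (search.den n m s) := by
  obtain ⟨s₁, hs₁⟩ : ∃ s₁, s₁ = (set 9 (.num 0)).den n m (countReps.den n m s) := ⟨_, rfl⟩
  have hmem : s₁.mem = s.mem := by
    rw [hs₁]; exact Cmd.den_mem_eq countReps rfl _
  have hrmem : s₁.rmem = s.rmem := by
    rw [hs₁]; exact Cmd.den_rmem_eq countReps rfl _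
  have h13 : s₁.reg 13 = (s.reps n).card := by rw [hs₁]; exact countReps_spec
  have key := iter_induction (b := m) (x := 2) (s := s₁) (f := (forN 7 tryStar).den n m)
    (fun i s' => s'.mem = s.mem ∧ s'.rmem = s.rmem ∧ s'.reg 13 = (s.reps n).card ∧
      Best (s.table n m) (s.wt m) (s.reps n) (fun e _ => (e : ℕ) < i) s')
    ⟨hmem, hrmem, h13, .inl ⟨by rw [hs₁]; simp [den, IExp.eval], by simp⟩⟩ ?_
  · have : search.den n m s = iter 2 ((forN 7 tryStar).den n m) m s₁ := by rw [hs₁]; rfl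
    rw [this]
    exact ⟨key.2.2.1, key.2.2.2.congr rfl rfl rfl rfl rfl fun e _ _ _ => e.2⟩
  · rintro i s' hi ⟨k1, k2, k3, k4⟩
    have key' := iter_induction (b := n) (x := 7) (s := s'.setReg 2 i) (f := tryStar.den n m)
      (fun j s'' => s''.mem = s.mem ∧ s''.rmem = s.rmem ∧ s''.reg 13 = (s.reps n).card ∧
        s''.reg 2 = i ∧ Best (s.table n m) (s.wt m) (s.reps n)
          (fun e v => (e : ℕ) < i ∨ ((e : ℕ) = i ∧ (v : ℕ) < j)) s'')
      ⟨k1, k2, k3, rfl, k4.congr rfl rfl rfl rfl rfl fun e v he _ => by simpa using he⟩ ?_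
    · obtain ⟨l1, l2, l3, -, l4⟩ := key'
      refine ⟨l1, l2, l3, l4.congr rfl rfl rfl rfl rfl fun e v he _ => ?_⟩
      have := v.2
      omega
    · rintro j s'' hj ⟨l1, l2, l3, l4, l5⟩
      have ht : (s''.setReg 7 j).table n m = s.table n m := by
        simp only [State.table, State.setReg, l1, l2]
      have hw : (s''.setReg 7 j).wt m = s.wt m := by
        funext e
        simp only [State.wt, State.setReg, l2]
      have hr : (s''.setReg 7 j).reps n = s.reps n := by
        simp only [State.reps, State.setReg, l1]
      have := tryStar_spec (s := s''.setReg 7 j) (e := ⟨i, hi⟩) (v₀ := ⟨j, hj⟩)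
        (D := fun e v => (e : ℕ) < i ∨ ((e : ℕ) = i ∧ (v : ℕ) < j)) l4 rfl
        (by rw [hr]; exact l3)
        (by rw [ht, hw, hr]; exact l5.congr rfl rfl rfl rfl rfl fun _ _ h _ => h)
      rw [ht, hw, hr] at this
      refine ⟨(Cmd.den_mem_eq _ rfl _).trans l1, (Cmd.den_rmem_eq _ rfl _).trans l2,
        (Cmd.den_reg _ (by decide)).trans l3, (Cmd.den_reg _ (by decide)).trans l4,
        this.congr rfl rfl rfl rfl rfl fun e v he _ => ?_⟩
      simp only [Fin.ext_iff]
      omega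

end RAM

namespace RAM

open Finset WHypergraph Cmd

open scoped Classical

variable {n m : ℕ} {G : WHypergraph n m} {s : State} {S : Finset (Fin n)}

/-! ### Buying a star -/

theorem mem_outSet {g : Fin m} : g ∈ s.outSet m ↔ s.mem 2 g = 1 := by simp [State.outSet]

theorem mem_reps {v : Fin n} : v ∈ s.reps n ↔ s.mem 3 v = 1 := by simp [State.reps]

theorem addPath_spec {e v : ℕ} (h10 : s.reg 10 = e) (h5 : s.reg 5 = v) (g : Fin m) :
    (addPath.den n m s).mem 2 g = 1 ↔ s.mem 2 g = 1 ∨ s.mem 6 ((e * n + v) * m + g) = 1 := by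
  have key := iter_induction (b := m) (x := 6) (s := s)
    (f := (when (flag 6 (ix3 10 5 6)) (store 2 (.var 6) (.num 1))).den n m)
    (fun i s' => s'.reg 10 = e ∧ s'.reg 5 = v ∧ s'.mem 6 = s.mem 6 ∧ ∀ g : Fin m,
      s'.mem 2 g = 1 ↔ s.mem 2 g = 1 ∨ ((g : ℕ) < i ∧ s.mem 6 ((e * n + v) * m + g) = 1))
    ⟨h10, h5, rfl, by simp⟩ ?_
  · refine (key.2.2.2 g).trans ?_
    simp
  · rintro i s' _ ⟨k1, k2, k3, k4⟩
    refine ⟨(Cmd.den_reg _ (by decide)).trans k1, (Cmd.den_reg _ (by decide)).trans k2,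
      (Cmd.den_mem _ (by decide)).trans k3, fun g => ?_⟩
    have hc : (flag 6 (ix3 10 5 6)).Holds n m (s'.setReg 6 i) ↔
        s.mem 6 ((e * n + v) * m + i) = 1 := by
      simp [Cond.Holds, IExp.eval, State.setReg, k1, k2, k3]
    rw [den]
    by_cases h : s.mem 6 ((e * n + v) * m + i) = 1
    · rw [if_pos (hc.2 h)]
      simp only [den, IExp.eval, State.setReg, Function.update_self, Function.update_apply]
      split_ifs with hg
      · simp [hg, h]
      · rw [k4]
        have : (g : ℕ) < i + 1 ↔ (g : ℕ) < i := by omega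
        rw [this]
    · rw [if_neg (fun h' => h (hc.1 h'))]
      refine (k4 g).trans (or_congr_right (and_congr_left fun hg => ?_))
      have : (g : ℕ) ≠ i := fun h' => h (h' ▸ hg)
      omega

theorem buyPaths_spec {e : Fin m} {v₀ : Fin n} (h10 : s.reg 10 = e) (h11 : s.reg 11 = v₀) :
    (∀ g : Fin m, (buyPaths.den n m s).mem 2 g = 1 ↔ s.mem 2 g = 1 ∨
      ∃ v ∈ (s.table n m).ball (s.reps n) e v₀, g ∈ (s.table n m).path e v) ∧
    ∀ v : Fin n, (buyPaths.den n m s).mem 3 v = 1 ↔ s.mem 3 v = 1 ∧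
      v ∉ (s.table n m).ball (s.reps n) e v₀ := by
  have key := iter_induction (b := n) (x := 5) (s := s)
    (f := (when (inBall 10 11 5) (seq addPath (store 3 (.var 5) (.num 0)))).den n m)
    (fun i s' => (s'.reg 10 = e ∧ s'.reg 11 = v₀ ∧ s'.mem 5 = s.mem 5 ∧ s'.mem 6 = s.mem 6 ∧
        s'.rmem = s.rmem) ∧
      (∀ g : Fin m, s'.mem 2 g = 1 ↔ s.mem 2 g = 1 ∨
        ∃ v : Fin n, (v : ℕ) < i ∧ v ∈ (s.table n m).ball (s.reps n) e v₀ ∧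
          g ∈ (s.table n m).path e v) ∧
      ∀ v : Fin n, s'.mem 3 v = 1 ↔ s.mem 3 v = 1 ∧
        ¬ ((v : ℕ) < i ∧ v ∈ (s.table n m).ball (s.reps n) e v₀))
    ⟨⟨h10, h11, rfl, rfl, rfl⟩, by simp, by simp⟩ ?_
  · refine ⟨fun g => (key.2.1 g).trans (by simp), fun v => (key.2.2 v).trans (by simp)⟩
  · rintro i s' hi ⟨⟨k1, k2, k3, k4, k5⟩, k6, k7⟩
    refine ⟨⟨(Cmd.den_reg _ (by decide)).trans k1, (Cmd.den_reg _ (by decide)).trans k2,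
      (Cmd.den_mem _ (by decide)).trans k3, (Cmd.den_mem _ (by decide)).trans k4,
      (Cmd.den_rmem_eq _ rfl _).trans k5⟩, ?_⟩
    have hc : (inBall 10 11 5).Holds n m (s'.setReg 5 i) ↔
        ⟨i, hi⟩ ∈ (s.table n m).ball (s.reps n) e v₀ := by
      have := k7 ⟨i, hi⟩
      simp only [lt_self_iff_false, false_and, not_false_eq_true, and_true] at this
      simp [inBall, Cond.Holds, IExp.eval, RExp.eval, State.setReg, k1, k2, k3, k5, this,
        Table.mem_ball, mem_reps, State.table]
    rw [den]
    by_cases h : ⟨i, hi⟩ ∈ (s.table n m).ball (s.reps n) e v₀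
    · rw [if_pos (hc.2 h)]
      constructor
      · intro g
        have hp : g ∈ (s.table n m).path e ⟨i, hi⟩ ↔ s'.mem 6 ((e * n + i) * m + g) = 1 := by
          simp [State.table, k4]
        refine (addPath_spec (s := s'.setReg 5 i) (v := i) k1 rfl g).trans ?_
        rw [show (s'.setReg 5 i).mem = s'.mem from rfl, k6, ← hp, or_assoc]
        refine or_congr_right ⟨?_, ?_⟩
        · rintro (⟨v, h1, h2⟩ | h1)
          · exact ⟨v, by omega, h2⟩
          · exact ⟨⟨i, hi⟩, Nat.lt_succ_self i, h, h1⟩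
        · rintro ⟨v, h1, h2⟩
          rcases Nat.lt_succ_iff_lt_or_eq.1 h1 with h1 | h1
          · exact .inl ⟨v, h1, h2⟩
          · obtain rfl : v = ⟨i, hi⟩ := Fin.ext h1
            exact .inr h2.2
      · intro v
        have hm : ((seq addPath (store 3 (.var 5) (.num 0))).den n m (s'.setReg 5 i)).mem 3 =
            Function.update (s'.mem 3) i 0 := by
          have e1 : (addPath.den n m (s'.setReg 5 i)).mem 3 = s'.mem 3 := Cmd.den_mem _ (by decide)
          have e2 : (addPath.den n m (s'.setReg 5 i)).reg 5 = i :=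
            (Cmd.den_reg _ (by decide)).trans (State.setReg_reg_self ..)
          simp only [den, IExp.eval, Function.update_self, e1, e2]
        rw [hm, Function.update_apply]
        split_ifs with hv
        · obtain rfl : v = ⟨i, hi⟩ := Fin.ext hv
          simp [h]
        · rw [k7]
          have : (v : ℕ) < i + 1 ↔ (v : ℕ) < i := by omega
          rw [this]
    · rw [if_neg (fun h' => h (hc.1 h'))]
      have hlt : ∀ v : Fin n, v ∈ (s.table n m).ball (s.reps n) e v₀ →
          ((v : ℕ) < i ↔ (v : ℕ) < i + 1) := fun v hv => by
        have : (v : ℕ) ≠ i := fun h' => h ((Fin.ext h' : v = ⟨i, hi⟩) ▸ hv)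
        omega
      constructor
      · refine fun g => (k6 g).trans (or_congr_right (exists_congr fun v => ?_))
        exact and_congr_left fun hv => hlt v hv.1
      · refine fun v => (k7 v).trans (and_congr_right fun _ => not_congr ?_)
        exact and_congr_left fun hv => hlt v hv

theorem buyCmd_spec {e : Fin m} {v₀ : Fin n} (h9 : s.reg 9 = 1) (h10 : s.reg 10 = e)
    (h11 : s.reg 11 = v₀) (h13 : s.reg 13 = (s.reps n).card) :
    (buyCmd.den n m s).outSet m = (s.table n m).buy (s.reps n) e v₀ (s.outSet m) ∧
    (buyCmd.den n m s).reps n = (s.table n m).shrink (s.reps n) e v₀ := by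
  obtain ⟨k1, k2⟩ := buyPaths_spec (s := s) h10 h11
  obtain ⟨s₁, hs₁⟩ : ∃ s₁, s₁ = buyPaths.den n m s := ⟨_, rfl⟩
  have l10 : s₁.reg 10 = e := by rw [hs₁]; exact (Cmd.den_reg _ (by decide)).trans h10
  have l11 : s₁.reg 11 = v₀ := by rw [hs₁]; exact (Cmd.den_reg _ (by decide)).trans h11
  have l13 : s₁.reg 13 = (s.reps n).card := by
    rw [hs₁]; exact (Cmd.den_reg _ (by decide)).trans h13
  rw [← hs₁] at k1 k2
  have hden : buyCmd.den n m s = (seq (store 2 (.var 10) (.num 1))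
      (when (.le (.num 2) (.var 13)) (store 3 (.var 11) (.num 1)))).den n m s₁ := by
    rw [hs₁]
    exact if_pos h9
  rw [hden]
  constructor
  · ext g
    have hm : ((seq (store 2 (.var 10) (.num 1)) (when (.le (.num 2) (.var 13))
        (store 3 (.var 11) (.num 1)))).den n m s₁).mem 2 = Function.update (s₁.mem 2) e 1 := by
      rw [den, Cmd.den_mem _ (by decide)]
      simp [den, IExp.eval, l10]
    rw [mem_outSet, hm, Function.update_apply, Table.buy, mem_union, mem_insert, mem_biUnion,
      mem_outSet]
    split_ifs with h <;> rw [← Fin.ext_iff] at h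
    · simp [h]
    · simp [h, k1]
  · ext v
    have hm : ((seq (store 2 (.var 10) (.num 1)) (when (.le (.num 2) (.var 13))
        (store 3 (.var 11) (.num 1)))).den n m s₁).mem 3 =
        if 2 ≤ (s.reps n).card then Function.update (s₁.mem 3) v₀ 1 else s₁.mem 3 := by
      simp only [den, Cond.Holds, IExp.eval, l13]
      split_ifs
      · simp [l11]
      · simp
    rw [mem_reps, hm, Table.shrink]
    split_ifs with h
    · rw [Function.update_apply, mem_insert, mem_sdiff, mem_reps]
      split_ifs with h' <;> rw [← Fin.ext_iff] at h'
      · simp [h']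
      · simp [h', k2]
    · rw [mem_sdiff, mem_reps, k2]

/-! ### One step of the greedy algorithm -/

/-- The configuration holds the instance. -/
structure State.Holds (s : State) (G : WHypergraph n m) : Prop where
  encodes : s.Encodes G
  weight : ∀ e : Fin m, s.rmem 0 e = G.weight e

theorem State.Holds.den {c : Cmd} (h : s.Holds G) (h0 : 0 ∉ c.arrays) (h0' : 0 ∉ c.rarrays) :
    (c.den n m s).Holds G :=
  ⟨fun e v => by rw [c.den_mem h0]; exact h.encodes e v,
    fun e => by rw [c.den_rmem h0']; exact h.weight e⟩

/-- Initially exactly the pairs with `v` in `e` are known, with distance zero and empty path. This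
is the base case that `rounds_spec` needs. -/
theorem fillTable_spec (h : s.Holds G) :
    ((fillTable.den n m s).table n m).IsShortest G (G.residual (s.outSet m)) ∧
      (fillTable.den n m s).wt m = G.residual (s.outSet m) := by
  obtain ⟨h1, h2⟩ := tableInit_spec (n := n) (m := m) (s := s)
  have hG : (tableInit.den n m s).Holds G := h.den (by decide) (by decide)
  have hwt : (tableInit.den n m s).wt m = G.residual (s.outSet m) := by
    funext e
    rw [State.wt, (h2 e e.2).1, State.resid, WHypergraph.residual, hG.weight, h1.sol]
    simp only [mem_outSet]
  have hk : ∀ (e : Fin m) (v : Fin n), ((tableInit.den n m s).table n m).known e v ↔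
      v ∈ G.edge e := fun e v => by
    rw [← hG.encodes e v, ← ((h2 e e.2).2 v v.2).1]
    rfl
  have hd : ∀ (e : Fin m) (v : Fin n), ((tableInit.den n m s).table n m).dist e v = 0 :=
    fun e v => ((h2 e e.2).2 v v.2).2.1
  have hp : ∀ (e : Fin m) (v : Fin n), ((tableInit.den n m s).table n m).path e v = ∅ :=
    fun e v => by
      refine filter_eq_empty_iff.2 fun g _ => ?_
      rw [((h2 e e.2).2 v v.2).2.2 g g.2]
      exact zero_ne_one
  have := rounds_spec hG.encodes (by rw [hwt]; exact residual_nonneg _)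
    ⟨fun e v h => by rw [hp]; exact Joins.start ((hk e v).1 h),
      fun e v _ => by rw [hp, hd, sum_empty]⟩
    (fun e v h => ⟨(hk e v).2 h, (hd e v).le⟩)
  rw [hwt] at this
  refine ⟨this, hwt ▸ funext fun e => congrFun ?_ (e : ℕ)⟩
  exact Cmd.den_rmem (forM 14 relaxRound) (a := 1) (by decide)

theorem greedyStep_cases (h : s.Holds G) :
    ∃ A : Table n m, A.IsShortest G (G.residual (s.outSet m)) ∧
      (((∀ e v, ¬ A.IsStar (s.reps n) e v) ∧ (greedyStep.den n m s).outSet m = s.outSet m ∧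
          (greedyStep.den n m s).reps n = s.reps n) ∨
        ∃ e v, A.IsStar (s.reps n) e v ∧
          (∀ e' v', A.IsStar (s.reps n) e' v' →
            A.starCost (G.residual (s.outSet m)) (s.reps n) e v / (A.ball (s.reps n) e v).card ≤
            A.starCost (G.residual (s.outSet m)) (s.reps n) e' v' /
              (A.ball (s.reps n) e' v').card) ∧
          (greedyStep.den n m s).outSet m = A.buy (s.reps n) e v (s.outSet m) ∧
          (greedyStep.den n m s).reps n = A.shrink (s.reps n) e v) := by
  obtain ⟨s₁, hs₁⟩ : ∃ s₁, s₁ = fillTable.den n m s := ⟨_, rfl⟩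
  obtain ⟨s₂, hs₂⟩ : ∃ s₂, s₂ = search.den n m s₁ := ⟨_, rfl⟩
  obtain ⟨hA, hwt⟩ := fillTable_spec h
  have hout : s₁.outSet m = s.outSet m := by
    unfold State.outSet; rw [hs₁, Cmd.den_mem _ (by decide)]
  have hreps : s₁.reps n = s.reps n := by
    unfold State.reps; rw [hs₁, Cmd.den_mem _ (by decide)]
  have hmem : s₂.mem = s₁.mem := by rw [hs₂]; exact Cmd.den_mem_eq search rfl _
  have hrmem : s₂.rmem = s₁.rmem := by rw [hs₂]; exact Cmd.den_rmem_eq search rfl _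
  have hout' : s₂.outSet m = s.outSet m := by rw [← hout]; unfold State.outSet; rw [hmem]
  have hreps' : s₂.reps n = s.reps n := by rw [← hreps]; unfold State.reps; rw [hmem]
  have htab' : s₂.table n m = s₁.table n m := by unfold State.table; rw [hmem, hrmem]
  have hden : greedyStep.den n m s = buyCmd.den n m s₂ := by rw [hs₂, hs₁]; rfl
  obtain ⟨h13, hb⟩ := search_spec (n := n) (m := m) (s := s₁)
  rw [← hs₁] at hA hwt
  rw [← hs₂, hwt, hreps] at hb
  rw [← hs₂, hreps] at h13
  refine ⟨_, hA, ?_⟩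
  rcases hb with ⟨h9, hno⟩ | ⟨h9, e, v, h10, h11, hs, -, -, hmin⟩
  · refine .inl ⟨fun e v => hno e v trivial, ?_⟩
    have : buyCmd.den n m s₂ = s₂ := if_neg (by simpa [Cond.Holds, IExp.eval] using h9)
    rw [hden, this]
    exact ⟨hout', hreps'⟩
  · obtain ⟨k1, k2⟩ := buyCmd_spec h9 h10 h11 (h13.trans (by rw [hreps']))
    rw [htab', hreps'] at k1 k2
    rw [hout'] at k1
    exact .inr ⟨e, v, hs, fun e' v' => hmin e' v' trivial, by rw [hden, k1], by rw [hden, k2]⟩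

theorem greedyStep_progress (h : s.Holds G) (hp : G.Progress S (s.outSet m) (s.reps n)) :
    G.Progress S ((greedyStep.den n m s).outSet m) ((greedyStep.den n m s).reps n) := by
  obtain ⟨A, hA, ⟨_, h1, h2⟩ | ⟨e, v, hs, _, h1, h2⟩⟩ := greedyStep_cases h
  · rwa [h1, h2]
  · rw [h1, h2]
    exact hp.step hA hs

/-- When a solution `u` exists, a failed search means that no representative is left; otherwise the
purchase is paid for by the decrease of `factor`. -/
theorem greedyStep_cost (h : s.Holds G) (hp : G.Progress S (s.outSet m) (s.reps n))
    {u : Finset (Fin m)} (hu : u ∈ G.steinerSets S) :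
    ((greedyStep.den n m s).reps n).card ≤ (s.reps n).card - 1 ∧
    G.cost ((greedyStep.den n m s).outSet m) ≤ G.cost (s.outSet m) +
      (factor (s.reps n).card - factor ((greedyStep.den n m s).reps n).card) * G.cost u := by
  obtain ⟨A, hA, ⟨hno, h1, h2⟩ | ⟨e, v, hs, hmin, h1, h2⟩⟩ := greedyStep_cases h
  · have h0 : s.reps n = ∅ := by
      by_contra hne
      obtain ⟨e, v, hs⟩ := Table.exists_isStar hA hu.1 (hp.1.trans hu.2) (nonempty_iff_ne_empty.2 hne)
      exact hno e v hs
    rw [h1, h2, h0]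
    simp
  · rw [h1, h2]
    constructor
    · rcases Table.card_shrink hs with h | h <;> omega
    · exact (Table.cost_buy_le hA e v).trans
        (add_le_add_right (Table.starCost_le hA hs hmin hu.1 (hp.1.trans hu.2)) _)

/-! ### The whole program -/

theorem initCmd_spec : (initCmd.den n m (source G S)).reps n = S := by
  have key := iter_induction (b := n) (x := 5) (s := source G S)
    (f := (store 3 (.var 5) (.load 1 (.var 5))).den n m)
    (fun i s' => s'.mem 1 = (source G S).mem 1 ∧
      ∀ v : Fin n, (v : ℕ) < i → s'.mem 3 v = (source G S).mem 1 v) ⟨rfl, by simp⟩ ?_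
  · ext v
    rw [mem_reps]
    refine (iff_of_eq (congrArg (· = 1) (key.2 v v.2))).trans ?_
    simp only [source, input, one_ne_zero, if_false, if_true]
    split_ifs with h
    · obtain ⟨v', h, hv'⟩ := h
      rw [Fin.ext h]
      simpa using hv'
    · simpa using fun hv => h ⟨v, rfl, hv⟩
  · rintro i s' _ ⟨k1, k2⟩
    refine ⟨(Cmd.den_mem _ (by decide)).trans k1, fun v hv => ?_⟩
    simp only [den, IExp.eval, State.setReg, Function.update_self, Function.update_apply, k1]
    split_ifs with h
    · rw [h]
    · exact k2 v (by omega)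

theorem source_holds : (source G S).Holds G := by
  refine ⟨fun e v => ?_, fun e => ?_⟩
  · simp only [source, input, if_true]
    split_ifs with h
    · obtain ⟨e', v', h, hv'⟩ := h
      obtain ⟨h1, h2⟩ := (mul_add_inj v.2 v'.2).1 h
      rw [Fin.ext h1, Fin.ext h2]
      simpa using hv'
    · simpa using fun hv => h ⟨e, v, rfl, hv⟩
  · simp [source, input]

/-- Given a solution, at most `n - i` representatives remain after `i` rounds, so none after `n`.
The costs telescope to `factor S.card` because `factor 0 = 0`. -/
theorem greedyCmd_spec : G.Progress S ((greedyCmd.den n m (source G S)).outSet m)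
      ((greedyCmd.den n m (source G S)).reps n) ∧
    ∀ u ∈ G.steinerSets S, (greedyCmd.den n m (source G S)).reps n = ∅ ∧
      G.cost ((greedyCmd.den n m (source G S)).outSet m) ≤ factor S.card * G.cost u := by
  have hinit : (initCmd.den n m (source G S)).Holds G :=
    source_holds.den (by decide) (by decide)
  have hout : (initCmd.den n m (source G S)).outSet m = ∅ := by
    refine filter_eq_empty_iff.2 fun g _ => ?_
    rw [Cmd.den_mem _ (by decide)]
    simp [source, input]
  have key := iter_induction (b := n) (x := 1) (s := initCmd.den n m (source G S))
    (f := greedyStep.den n m)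
    (fun i s' => s'.Holds G ∧ G.Progress S (s'.outSet m) (s'.reps n) ∧
      ∀ u ∈ G.steinerSets S, (s'.reps n).card ≤ n - i ∧
        G.cost (s'.outSet m) ≤ (factor S.card - factor (s'.reps n).card) * G.cost u)
    ⟨hinit, ?_, fun u _ => ⟨by simpa using card_le_univ ((initCmd.den n m (source G S)).reps n), ?_⟩⟩ ?_
  · obtain ⟨-, h2, h3⟩ := key
    refine ⟨h2, fun u hu => ?_⟩
    obtain ⟨h4, h5⟩ := h3 u hu
    have h0 := card_eq_zero.1 (Nat.le_zero.1 (h4.trans (Nat.sub_self n).le))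
    refine ⟨h0, h5.trans ?_⟩
    rw [h0]
    simp [factor]
  · rw [hout, initCmd_spec]
    exact Progress.init S
  · rw [hout, initCmd_spec]
    simp [cost]
  · rintro i s' _ ⟨k1, k2, k3⟩
    have hh : (s'.setReg 1 i).Holds G := ⟨k1.encodes, k1.weight⟩
    refine ⟨hh.den (by decide) (by decide), greedyStep_progress hh k2, fun u hu => ?_⟩
    obtain ⟨h1, h2⟩ := greedyStep_cost hh k2 hu
    obtain ⟨h3, h4⟩ := k3 u hu
    change _ ≤ (s'.reps n).card - 1 at h1
    change _ ≤ G.cost (s'.outSet m) + (factor (s'.reps n).card - _) * _ at h2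
    exact ⟨by omega, by linarith⟩

theorem sumCost_spec (h : s.Holds G) :
    (sumCost.den n m s).rreg 0 = G.cost (s.outSet m) := by
  have key := iter_induction (b := m) (x := 6) (s := (rset 0 .zero).den n m s)
    (f := (when (flag 2 (.var 6)) (rset 0 (.add (.var 0) (.load 0 (.var 6))))).den n m)
    (fun i s' => s'.mem = s.mem ∧ s'.rmem = s.rmem ∧
      s'.rreg 0 = ∑ j ∈ range i, if s.mem 2 j = 1 then s.rmem 0 j else 0)
    ⟨rfl, rfl, by simp [den, RExp.eval]⟩ ?_
  · refine key.2.2.trans ?_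
    rw [sum_range, cost, State.outSet, sum_filter]
    exact sum_congr rfl fun e _ => by rw [h.weight]
  · rintro i s' _ ⟨k1, k2, k3⟩
    refine ⟨(Cmd.den_mem_eq _ rfl _).trans k1, (Cmd.den_rmem_eq _ rfl _).trans k2, ?_⟩
    rw [sum_range_succ, ← k3]
    simp only [den, Cond.Holds, IExp.eval, RExp.eval, State.setReg, Function.update_self, k1, k2]
    split_ifs <;> simp

theorem answer_spec : (answer.den n m s).reg 0 = 1 ↔ s.reps n = ∅ := by
  have h : (answer.den n m s).reg 0 = if (s.reps n).card ≤ 0 then 1 else 0 := by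
    have h13 : (countReps.den n m s).reg 13 = (s.reps n).card := countReps_spec
    simp [answer, den, Cond.Holds, IExp.eval, State.setReg, h13]
    split_ifs <;> simp
  rw [h]
  split_ifs with h0
  · simpa using h0
  · simpa [card_eq_zero] using h0

theorem steinerCmd_spec : ((steinerCmd.den n m (source G S)).reg 0 = 1 ↔
      (G.steinerSets S).Nonempty) ∧
    (steinerCmd.den n m (source G S)).rreg 0 =
      G.cost ((steinerCmd.den n m (source G S)).outSet m) ∧
    ∀ u ∈ G.steinerSets S, (steinerCmd.den n m (source G S)).outSet m ∈ G.steinerSets S ∧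
      G.cost ((steinerCmd.den n m (source G S)).outSet m) ≤ factor S.card * G.cost u := by
  obtain ⟨s₁, hs₁⟩ : ∃ s₁, s₁ = greedyCmd.den n m (source G S) := ⟨_, rfl⟩
  obtain ⟨hp, hc⟩ := greedyCmd_spec (G := G) (S := S)
  rw [← hs₁] at hp hc
  have hh : s₁.Holds G := by rw [hs₁]; exact source_holds.den (by decide) (by decide)
  have hden : steinerCmd.den n m (source G S) = sumCost.den n m (answer.den n m s₁) := by
    rw [hs₁]; rfl
  have hout' : (answer.den n m s₁).outSet m = s₁.outSet m := by
    unfold State.outSet; rw [Cmd.den_mem _ (by decide)]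
  have hout : (sumCost.den n m (answer.den n m s₁)).outSet m = s₁.outSet m := by
    unfold State.outSet; rw [Cmd.den_mem _ (by decide), Cmd.den_mem _ (by decide)]
  rw [hden, hout, Cmd.den_reg _ (by decide), answer_spec,
    sumCost_spec (hh.den (c := answer) (by decide) (by decide)), hout']
  refine ⟨⟨fun h => ⟨_, hp.2.2 h⟩, fun ⟨u, hu⟩ => (hc u hu).1⟩, rfl, fun u hu => ?_⟩
  exact ⟨hp.2.2 (hc u hu).1, (hc u hu).2⟩

end RAM

/-! ### The main theorem -/

theorem mainTheorem5 :
    ∃ (p : RAM.Prog) (T : Polynomial ℕ) (C : ℝ),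
      ∀ (n m : ℕ) (G : WHypergraph n m) (S : Finset (Fin n)),
        ∃ (k : ℕ) (s : RAM.State),
          RAM.Exec p (RAM.input G S) k s ∧
          k ≤ T.eval (n + m) ∧
          (s.Accepts ↔ (G.steinerSets S).Nonempty) ∧
          ((G.steinerSets S).Nonempty →
            s.outSet m ∈ G.steinerSets S ∧
            s.outValue = G.cost (s.outSet m) ∧
            G.cost (s.outSet m) ≤ max 1 (C * Real.log S.card) * G.hsp S ∧
            G.cost (s.outSet m) ≤ max 1 (C * Real.log n) * G.hsp S) := by
  -- The constant `4` is that of `factor_le`, and the two extra steps load the constants.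
  refine ⟨RAM.steinerCmd.prog, RAM.steinerCmd.time + 2, 4, fun n m G S => ?_⟩
  obtain ⟨k, s, hexec, hk, hsim⟩ := RAM.steinerCmd.prog_spec G S
  obtain ⟨h1, h2, h3⟩ := RAM.steinerCmd_spec (G := G) (S := S)
  have hreg : s.reg 0 = _ := hsim.reg 0
  have hrreg : s.rreg 0 = _ := hsim.rreg 0
  have hout : s.outSet m = (RAM.steinerCmd.den n m (RAM.source G S)).outSet m := by
    unfold RAM.State.outSet
    rw [hsim.mem]
  refine ⟨k, s, hexec, hk, ?_, fun hne => ?_⟩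
  · rw [RAM.State.Accepts, hreg, h1]
  · obtain ⟨⟨u, hu, hcost⟩, -⟩ := G.isLeast_hsp S hne
    obtain ⟨h4, h5⟩ := h3 u hu
    have hpos : 0 ≤ G.hsp S := by
      rw [← hcost]
      exact Finset.sum_nonneg fun e _ => G.weight_nonneg e
    rw [hout]
    rw [hcost] at h5
    have h6 := h5.trans (mul_le_mul_of_nonneg_right (WHypergraph.factor_le S.card) hpos)
    refine ⟨h4, hrreg.trans h2, h6, h6.trans (mul_le_mul_of_nonneg_right ?_ hpos)⟩
    refine max_le_max le_rfl ?_
    -- Monotonicity of the logarithm needs a positive argument; for empty `S` the convention `log 0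
    -- = 0` is used instead.
    rcases Nat.eq_zero_or_pos S.card with h0 | h0
    · rw [h0, Nat.cast_zero, Real.log_zero, mul_zero]
      exact mul_nonneg (by norm_num) (Real.log_natCast_nonneg n)
    · have hle : S.card ≤ n := by simpa using S.card_le_univ
      have := Real.log_le_log (by exact_mod_cast h0) (Nat.cast_le (α := ℝ).2 hle)
      linarith
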